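/- **Setting.** Let $V:\mathbb R\to\mathbb R$ be a $C^2$ non-negative potential that is well behaved at infinity of exponential order $N$: $V(\phi)>0$ for all large $\phi$ and $W_V(\phi):=V'(\phi)/V(\phi)-N\to 0$ as $\phi\to\infty$. Suppose $V$ is of class 2: there are $\phi_0>0$ with $V>0$ on $[\phi_0,\infty)$ and a strictly decreasing $C^3$ map $z=f(\phi)$ of $[\phi_0,\infty)$ onto $(0,\epsilon]$, $\epsilon=f(\phi_0)$, with $f\to0$ at $\infty$, such that the functions $\overline{W}_V(z)=W_V(f^{-1}(z))$ and $\overline{f'}(z)=f'(f^{-1}(z))$, extended to $z=0$ by their limits, are $C^2$ on $[0,\epsilon]$ with vanishing first derivative at $z=0$. Fix any such $f$, $\phi_0$, and assume $N^2<6$. A *cosmology* is a solution $(\phi,\dot\phi,K)$, on an open interval of proper time $t$, of $\ddot\phi=-K\dot\phi-V'(\phi)$, $\dot K=-\tfrac32\dot\phi^2$, $K^2=3V(\phi)+\tfrac32\dot\phi^2$, $K>0$. With $y=\sqrt{3/2}\,\dot\phi/K$, $z=f(\phi)$, $d\tau=K\,dt$, the part of phase space with $\phi>\phi_0$ becomes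 $\Omega=\{-1<y<1,\ 0<z<\epsilon\}$ with $$\frac{dy}{d\tau}=-\Big(y+\tfrac1{\sqrt6}\big(\overline{W}_V(z)+N\big)\Big)(1-y^2),\qquad \frac{dz}{d\tau}=\sqrt{\tfrac23}\,\overline{f'}(z)\,y ,$$ a system which extends to $\tilde\Omega=\{-1\le y\le1,\ 0\le z<\epsilon\}$ and has the equilibrium $p_N=(-N/\sqrt6,0)$. A solution is *past-asymptotic* to $p_N$ if it is defined on some $(-\infty,T]$ and tends to $p_N$ as $\tau\to-\infty$. A cosmology *originates at $p_N$* if $\phi\to\infty$ and $y\to-N/\sqrt6$ as $t$ decreases to the left end of its interval. A *local center manifold* of $p_N$ is a curve $y=h(z)$, $0\le z<\delta$, in $\tilde\Omega$ with $h\in C^1$, $h(0)=-N/\sqrt6$, $h'(0)=0$, which is locally invariant: a solution in $\tilde\Omega$ that meets it stays in it, in both time directions, as long as $z<\delta$. **Theorem.** 1. $p_N$ has a local center manifold, and every solution in $\tilde\Omega$ past-asymptotic to $p_N$ lies, for all sufficiently negative $\tau$, in each local center manifold of $p_N$. 2. There is a single orbit $C_N$ of the system in $\Omega$ such that every solution in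 $\tilde\Omega$ past-asymptotic to $p_N$ lies in $C_N\cup\{p_N\}$, and every cosmology originating at $p_N$ satisfies $(y,z)\in C_N$ for all sufficiently early times. If $V'(\phi)\ne0$ for all sufficiently large $\phi$ (which is automatic if $N\neq0$), then $C_N$ can be chosen so that, in addition, $C_N\cup\{p_N\}$ coincides in a neighbourhood of $p_N$ with a local center manifold of $p_N$. 3. If $V'$ has arbitrarily large zeros, then no solution in $\Omega$ is past-asymptotic to $p_N$. 4. At most one cosmology originates at $p_N$: for any two such cosmologies there is a translation of time after which their time intervals coincide towards the past and $\phi$, $\dot\phi$ and $K$ agree at all common times. -/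

import Mathlib

open Filter Topology

noncomputable section

namespace ScalarCosmology

/-! ### Potentials that are well behaved at infinity -/

/-- `W_V(φ) = V'(φ) / V(φ) - N`. -/
def W (V : ℝ → ℝ) (N : ℝ) (φ : ℝ) : ℝ := deriv V φ / V φ - N

/-- `V` is a `C²` non-negative potential which is well behaved at infinity, of exponential
order `N`. -/
def IsWBI (V : ℝ → ℝ) (N : ℝ) : Prop :=
  ContDiff ℝ 2 V ∧ (∀ φ, 0 ≤ V φ) ∧
    (∃ φ₁ : ℝ, 0 < φ₁ ∧ ∀ φ, φ₁ < φ → 0 < V φ) ∧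
    Tendsto (W V N) atTop (𝓝 0)

/-- The function `z ↦ g (f⁻¹ z)` for `z > 0`, extended to `z = 0` by the limit of `g` at `∞`.
Here `f⁻¹` is the inverse of `f` on `[φ₀, ∞)`. If the extended function is continuous at `0`
from the right then the limit exists, so no junk value is involved there. -/
def bar (f : ℝ → ℝ) (φ₀ : ℝ) (g : ℝ → ℝ) (z : ℝ) : ℝ :=
  if 0 < z then g (Function.invFunOn f (Set.Ici φ₀) z) else limUnder atTop g

/-- `W_V` as a function of `z = f φ`. -/
def Wbar (V : ℝ → ℝ) (N : ℝ) (f : ℝ → ℝ) (φ₀ : ℝ) : ℝ → ℝ := bar f φ₀ (W V N)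

/-- `f'` as a function of `z = f φ`. -/
def fbar (f : ℝ → ℝ) (φ₀ : ℝ) : ℝ → ℝ := bar f φ₀ (derivWithin f (Set.Ici φ₀))

/-- `z = f φ`, `φ ≥ φ₀`, is a coordinate which takes `∞` to `0` and in which `V` is of
class `k` at infinity. -/
structure IsAdmissibleCoordinate (k : ℕ) (V : ℝ → ℝ) (N : ℝ) (f : ℝ → ℝ) (φ₀ : ℝ) : Prop where
  pos : 0 < φ₀
  V_pos : ∀ φ, φ₀ ≤ φ → 0 < V φ
  onto : f '' Set.Ici φ₀ = Set.Ioc 0 (f φ₀)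
  tendsto : Tendsto f atTop (𝓝 0)
  contDiffOn : ContDiffOn ℝ (k + 1) f (Set.Ici φ₀)
  strictAntiOn : StrictAntiOn f (Set.Ici φ₀)
  contDiffOn_Wbar : ContDiffOn ℝ k (Wbar V N f φ₀) (Set.Icc 0 (f φ₀))
  contDiffOn_fbar : ContDiffOn ℝ k (fbar f φ₀) (Set.Icc 0 (f φ₀))
  deriv_Wbar : derivWithin (Wbar V N f φ₀) (Set.Icc 0 (f φ₀)) 0 = 0
  deriv_fbar : derivWithin (fbar f φ₀) (Set.Icc 0 (f φ₀)) 0 = 0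

/-- `V` is class `k` well behaved at infinity, of exponential order `N`. -/
def IsClassWBI (k : ℕ) (V : ℝ → ℝ) (N : ℝ) : Prop :=
  IsWBI V N ∧ ContDiff ℝ k V ∧ ∃ (f : ℝ → ℝ) (φ₀ : ℝ), IsAdmissibleCoordinate k V N f φ₀

/-! ### The two-dimensional system near `φ = ∞`, in the coordinates `(y, z)` -/

/-- The vector field of the system
`dy/dτ = -(y + (W̄(z) + N)/√6) (1 - y²)`, `dz/dτ = √(2/3) f̄'(z) y`. -/
def field (V : ℝ → ℝ) (N : ℝ) (f : ℝ → ℝ) (φ₀ : ℝ) (p : ℝ × ℝ) : ℝ × ℝ :=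
  (-(p.1 + 1 / √6 * (Wbar V N f φ₀ p.2 + N)) * (1 - p.1 ^ 2),
    √(2 / 3) * fbar f φ₀ p.2 * p.1)

/-- The physical phase space `-1 < y < 1`, `0 < z < f φ₀`. -/
def phaseSpace (f : ℝ → ℝ) (φ₀ : ℝ) : Set (ℝ × ℝ) :=
  Set.Ioo (-1) 1 ×ˢ Set.Ioo 0 (f φ₀)

/-- The phase space with its three unphysical boundary pieces `y = 1`, `y = -1`, `z = 0`. -/
def extPhaseSpace (f : ℝ → ℝ) (φ₀ : ℝ) : Set (ℝ × ℝ) :=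
  Set.Icc (-1) 1 ×ˢ Set.Ico 0 (f φ₀)

/-- `γ`, restricted to `I`, is a solution of `γ' = X γ` with values in `D`. -/
def IsSolutionOn (X : ℝ × ℝ → ℝ × ℝ) (D : Set (ℝ × ℝ)) (I : Set ℝ) (γ : ℝ → ℝ × ℝ) : Prop :=
  ∀ τ ∈ I, γ τ ∈ D ∧ HasDerivWithinAt γ (X (γ τ)) I τ

/-- `C` is an orbit of `X` in `D`: all points that are joined to some point of `D`, forwards or
backwards in time, by a solution in `D`. -/
def IsOrbit (X : ℝ × ℝ → ℝ × ℝ) (D : Set (ℝ × ℝ)) (C : Set (ℝ × ℝ)) : Prop :=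
  ∃ p ∈ D, C = {q | ∃ (γ : ℝ → ℝ × ℝ) (s t : ℝ),
    IsSolutionOn X D (Set.uIcc s t) γ ∧ γ s = p ∧ γ t = q}

/-- The equilibrium `p_N = (-N/√6, 0)`. -/
def pN (N : ℝ) : ℝ × ℝ := (-N / √6, 0)

/-- `γ` is a solution on `(-∞, T]` with values in `D` which converges to `p_N` in the past. -/
def IsPastAsymptotic (V : ℝ → ℝ) (N : ℝ) (f : ℝ → ℝ) (φ₀ : ℝ) (D : Set (ℝ × ℝ)) (T : ℝ)
    (γ : ℝ → ℝ × ℝ) : Prop :=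
  IsSolutionOn (field V N f φ₀) D (Set.Iic T) γ ∧ Tendsto γ atBot (𝓝 (pN N))

/-- `M` is a local center manifold of `p_N` in the extended phase space (whose boundary contains
`p_N`): a `C¹` curve `y = h z`, `0 ≤ z < δ`, which starts at `p_N`, is tangent there to the
`z`-axis (the zero-eigenspace of the linearisation), and is locally invariant: a solution which
meets `M` stays in `M`, in both time directions, as long as `z < δ`. -/
def IsLocalCenterManifold (V : ℝ → ℝ) (N : ℝ) (f : ℝ → ℝ) (φ₀ : ℝ) (M : Set (ℝ × ℝ)) : Prop :=
  ∃ (δ : ℝ) (h : ℝ → ℝ), 0 < δ ∧ ContDiffOn ℝ 1 h (Set.Ico 0 δ) ∧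
    h 0 = -N / √6 ∧ derivWithin h (Set.Ico 0 δ) 0 = 0 ∧
    M = {p | p.2 ∈ Set.Ico 0 δ ∧ p.1 = h p.2} ∧ M ⊆ extPhaseSpace f φ₀ ∧
    ∀ (γ : ℝ → ℝ × ℝ) (s t : ℝ),
      IsSolutionOn (field V N f φ₀) (extPhaseSpace f φ₀) (Set.uIcc s t) γ →
      γ s ∈ M → (∀ τ ∈ Set.uIcc s t, (γ τ).2 < δ) → γ t ∈ M

/-- `C`, completed by the point `p_N`, is locally (in a neighbourhood of `p_N`) a center manifold
of `p_N`. -/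
def IsLocallyCenterManifold (V : ℝ → ℝ) (N : ℝ) (f : ℝ → ℝ) (φ₀ : ℝ) (C : Set (ℝ × ℝ)) : Prop :=
  ∃ M, IsLocalCenterManifold V N f φ₀ M ∧ ∃ U ∈ 𝓝 (pN N), insert (pN N) C ∩ U = M ∩ U

/-! ### Cosmologies -/

/-- An expanding spatially flat FRW scalar field cosmology on the interval `I` of proper time:
scalar field `φ`, its time derivative `ψ`, and expansion `K > 0`. -/
structure IsCosmology (V : ℝ → ℝ) (I : Set ℝ) (φ ψ K : ℝ → ℝ) : Prop where
  isOpen : IsOpen I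
  ordConnected : I.OrdConnected
  nonempty : I.Nonempty
  deriv_φ : ∀ t ∈ I, HasDerivAt φ (ψ t) t
  deriv_ψ : ∀ t ∈ I, HasDerivAt ψ (-K t * ψ t - deriv V (φ t)) t
  deriv_K : ∀ t ∈ I, HasDerivAt K (-(3 / 2) * ψ t ^ 2) t
  constraint : ∀ t ∈ I, K t ^ 2 = 3 * V (φ t) + 3 / 2 * ψ t ^ 2
  K_pos : ∀ t ∈ I, 0 < K t

/-- The coordinate `y = √(3/2) ψ / K`. -/
def yCoord (ψ K : ℝ → ℝ) (t : ℝ) : ℝ := √(3 / 2) * ψ t / K t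

/-- The cosmology originates at `p_N`: as `t` decreases to the left end of `I` (finite or
infinite), `φ → ∞` (that is, `z → 0`) and `y → -N/√6`. -/
def OriginatesAtPN (N : ℝ) (I : Set ℝ) (φ ψ K : ℝ → ℝ) : Prop :=
  Tendsto (fun t : I => φ t) atBot atTop ∧
    Tendsto (fun t : I => yCoord ψ K t) atBot (𝓝 (-N / √6))

/-- Up to a translation of time by `c` the two cosmologies start together and agree at all common
times. -/
def SameCosmology (I₁ : Set ℝ) (φ₁ ψ₁ K₁ : ℝ → ℝ) (I₂ : Set ℝ) (φ₂ ψ₂ K₂ : ℝ → ℝ) : Prop :=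
  ∃ c : ℝ, (∃ s ∈ I₁, ∀ t ≤ s, t ∈ I₁ ↔ t + c ∈ I₂) ∧
    ∀ t ∈ I₁, t + c ∈ I₂ → φ₁ t = φ₂ (t + c) ∧ ψ₁ t = ψ₂ (t + c) ∧ K₁ t = K₂ (t + c)

end ScalarCosmology

end

open ScalarCosmology

/-!
Near `p_N` the invariant graph `y = h(z)` solves `η(z) - h - G(z, h) h' = 0`, where `η(z) → 0` and
`G` vanishes at `z = 0`. It is a limit of solutions of this equation with an extra time derivative,
discretized in time along characteristics, which stay in a bounded set of `C^{1,1}` functions. The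
direction transverse to the graph is contracted forward in time, so a solution off the graph leaves
it exponentially fast backward in time: every solution past-asymptotic to `p_N` lies on every such
graph. Along solutions `log K²` decreases, strictly unless `y = 0`. On the graph `h` vanishes only
where `V'` does, so if `V'` has no large zeros then the graph without `p_N` is part of a single
orbit, while arbitrarily large zeros of `V'` give equilibria on the graph which block every
solution trying to reach `p_N`. Finally `z` decays at most exponentially in `τ`, so the past end of
a cosmology originating at `p_N` is `τ = -∞`; its trace near `p_N` lies on the graph, and the
constraint recovers `K` from `(y, z)`.
-/

namespace ScalarCosmology

/-! ### Functions of class `C^{1,1}` -/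

/-- `h` is of class `C^{1,1}` on `S` with derivative `h'`, Lipschitz constant `K` and quadratic
Taylor remainder `M (w - z)²`. Both functions are kept in the notion because, in this form, it is
visibly closed under pointwise limits. -/
structure IsC11On (S : Set ℝ) (K M : ℝ) (h h' : ℝ → ℝ) : Prop where
  abs_sub_le : ∀ z ∈ S, ∀ w ∈ S, |h w - h z| ≤ K * |w - z|
  abs_deriv_le : ∀ z ∈ S, |h' z| ≤ K
  taylor : ∀ z ∈ S, ∀ w ∈ S, |h w - h z - h' z * (w - z)| ≤ M * (w - z) ^ 2

theorem exists_pointwise_ultralimit {ι X Y : Type*} [TopologicalSpace Y] [Nonempty Y]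
    (𝓤 : Ultrafilter ι) {S : Set X} {T : Set Y} (hT : IsCompact T) {u : ι → X → Y}
    (hu : ∀ i, Set.MapsTo (u i) S T) :
    ∃ v : X → Y, Set.MapsTo v S T ∧ ∀ x ∈ S, Tendsto (fun i => u i x) 𝓤 (𝓝 (v x)) := by
  have hlim : ∀ x ∈ S, ∃ y ∈ T, Tendsto (fun i => u i x) 𝓤 (𝓝 y) := fun x hx =>
    hT.ultrafilter_le_nhds (𝓤.map fun i => u i x)
      (tendsto_principal.2 (Eventually.of_forall fun i => hu i hx))
  choose! v hvT hv using hlim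
  exact ⟨v, hvT, hv⟩

namespace IsC11On

variable {S S' : Set ℝ} {K M K₁ M₁ A B : ℝ} {h h' k k' : ℝ → ℝ}

theorem mono_const (H : IsC11On S K M h h') (hK : K ≤ K₁) (hM : M ≤ M₁) :
    IsC11On S K₁ M₁ h h' where
  abs_sub_le z hz w hw := (H.abs_sub_le z hz w hw).trans (by gcongr)
  abs_deriv_le z hz := (H.abs_deriv_le z hz).trans hK
  taylor z hz w hw := (H.taylor z hz w hw).trans (by gcongr)

theorem const (S : Set ℝ) (c : ℝ) : IsC11On S 0 0 (fun _ => c) fun _ => 0 where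
  abs_sub_le := by simp
  abs_deriv_le := by simp
  taylor := by simp

theorem id (S : Set ℝ) : IsC11On S 1 0 (fun z => z) fun _ => 1 where
  abs_sub_le := by simp
  abs_deriv_le := by simp
  taylor := by simp

theorem add (H : IsC11On S K M h h') (Hk : IsC11On S K₁ M₁ k k') :
    IsC11On S (K + K₁) (M + M₁) (fun z => h z + k z) fun z => h' z + k' z where
  abs_sub_le z hz w hw := by
    rw [add_sub_add_comm, add_mul]
    exact (abs_add_le _ _).trans (add_le_add (H.abs_sub_le z hz w hw) (Hk.abs_sub_le z hz w hw))
  abs_deriv_le z hz :=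
    (abs_add_le _ _).trans (add_le_add (H.abs_deriv_le z hz) (Hk.abs_deriv_le z hz))
  taylor z hz w hw := by
    rw [add_sub_add_comm, add_mul, add_sub_add_comm, add_mul]
    exact (abs_add_le _ _).trans (add_le_add (H.taylor z hz w hw) (Hk.taylor z hz w hw))

theorem const_mul (H : IsC11On S K M h h') (c : ℝ) :
    IsC11On S (|c| * K) (|c| * M) (fun z => c * h z) fun z => c * h' z where
  abs_sub_le z hz w hw := by
    rw [← mul_sub, abs_mul, mul_assoc]
    exact mul_le_mul_of_nonneg_left (H.abs_sub_le z hz w hw) (abs_nonneg c)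
  abs_deriv_le z hz := by
    rw [abs_mul]
    exact mul_le_mul_of_nonneg_left (H.abs_deriv_le z hz) (abs_nonneg c)
  taylor z hz w hw := by
    rw [← mul_sub, mul_assoc c, ← mul_sub, abs_mul, mul_assoc]
    exact mul_le_mul_of_nonneg_left (H.taylor z hz w hw) (abs_nonneg c)

theorem comp (H : IsC11On S' K M h h') (Hk : IsC11On S K₁ M₁ k k') (hk : Set.MapsTo k S S')
    (hK : 0 ≤ K) (hM : 0 ≤ M) :
    IsC11On S (K * K₁) (M * K₁ ^ 2 + K * M₁) (fun z => h (k z)) fun z => h' (k z) * k' z where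
  abs_sub_le z hz w hw := (H.abs_sub_le _ (hk hz) _ (hk hw)).trans <| by
    rw [mul_assoc]
    exact mul_le_mul_of_nonneg_left (Hk.abs_sub_le z hz w hw) hK
  abs_deriv_le z hz := by
    rw [abs_mul]
    exact mul_le_mul (H.abs_deriv_le _ (hk hz)) (Hk.abs_deriv_le z hz) (abs_nonneg _) hK
  taylor z hz w hw := by
    have hsq : (k w - k z) ^ 2 ≤ K₁ ^ 2 * (w - z) ^ 2 := by
      rw [← sq_abs (k w - k z), ← sq_abs (w - z), ← mul_pow]
      exact pow_le_pow_left₀ (abs_nonneg _) (Hk.abs_sub_le z hz w hw) 2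
    calc |h (k w) - h (k z) - h' (k z) * k' z * (w - z)|
        = |(h (k w) - h (k z) - h' (k z) * (k w - k z))
            + h' (k z) * (k w - k z - k' z * (w - z))| := by congr 1; ring
      _ ≤ M * (k w - k z) ^ 2 + K * (M₁ * (w - z) ^ 2) := by
          refine (abs_add_le _ _).trans (add_le_add (H.taylor _ (hk hz) _ (hk hw)) ?_)
          rw [abs_mul]
          exact mul_le_mul (H.abs_deriv_le _ (hk hz)) (Hk.taylor z hz w hw) (abs_nonneg _) hK
      _ ≤ M * (K₁ ^ 2 * (w - z) ^ 2) + K * (M₁ * (w - z) ^ 2) := by gcongr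
      _ = _ := by ring

theorem mul (H : IsC11On S K M h h') (Hk : IsC11On S K₁ M₁ k k') (hA : ∀ z ∈ S, |h z| ≤ A)
    (hB : ∀ z ∈ S, |k z| ≤ B) (hK : 0 ≤ K) (hA' : 0 ≤ A) (hM : 0 ≤ M) :
    IsC11On S (K * B + A * K₁) (M * B + A * M₁ + K * K₁) (fun z => h z * k z)
      fun z => h' z * k z + h z * k' z where
  abs_sub_le z hz w hw := by
    calc |h w * k w - h z * k z| = |(h w - h z) * k w + h z * (k w - k z)| := by congr 1; ring
      _ ≤ K * |w - z| * B + A * (K₁ * |w - z|) := by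
          refine (abs_add_le _ _).trans (add_le_add ?_ ?_) <;> rw [abs_mul]
          · exact mul_le_mul (H.abs_sub_le z hz w hw) (hB w hw) (abs_nonneg _) (by positivity)
          · exact mul_le_mul (hA z hz) (Hk.abs_sub_le z hz w hw) (abs_nonneg _) hA'
      _ = _ := by ring
  abs_deriv_le z hz := by
    refine (abs_add_le _ _).trans (add_le_add ?_ ?_) <;> rw [abs_mul]
    · exact mul_le_mul (H.abs_deriv_le z hz) (hB z hz) (abs_nonneg _) hK
    · exact mul_le_mul (hA z hz) (Hk.abs_deriv_le z hz) (abs_nonneg _) hA'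
  taylor z hz w hw := by
    calc |h w * k w - h z * k z - (h' z * k z + h z * k' z) * (w - z)|
        = |(h w - h z - h' z * (w - z)) * k w + h z * (k w - k z - k' z * (w - z))
            + h' z * ((w - z) * (k w - k z))| := by congr 1; ring
      _ ≤ M * (w - z) ^ 2 * B + A * (M₁ * (w - z) ^ 2) + K * (|w - z| * (K₁ * |w - z|)) := by
          refine (abs_add_three _ _ _).trans (add_le_add_three ?_ ?_ ?_) <;> rw [abs_mul]
          · exact mul_le_mul (H.taylor z hz w hw) (hB w hw) (abs_nonneg _) (by positivity)
          · exact mul_le_mul (hA z hz) (Hk.taylor z hz w hw) (abs_nonneg _) hA'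
          · rw [abs_mul]
            exact mul_le_mul (H.abs_deriv_le z hz)
              (mul_le_mul_of_nonneg_left (Hk.abs_sub_le z hz w hw) (abs_nonneg _))
              (by positivity) hK
      _ = M * (w - z) ^ 2 * B + A * (M₁ * (w - z) ^ 2) + K * (K₁ * |w - z| ^ 2) := by ring
      _ = _ := by rw [sq_abs]; ring

theorem hasDerivWithinAt (H : IsC11On S K M h h') {z : ℝ} (hz : z ∈ S) :
    HasDerivWithinAt h (h' z) S z := by
  rw [hasDerivWithinAt_iff_isLittleO]
  have hsq : (fun w : ℝ => (w - z) ^ 2) =o[𝓝[S] z] fun w => w - z := by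
    have hsub : Tendsto (fun w : ℝ => w - z) (𝓝[S] z) (𝓝 0) := by
      have hc : Continuous fun w : ℝ => w - z := by fun_prop
      simpa using (hc.tendsto z).mono_left (nhdsWithin_le_nhds (s := S))
    simpa only [Function.comp_def, pow_one] using
      (Asymptotics.isLittleO_pow_pow one_lt_two).comp_tendsto hsub
  refine Asymptotics.IsBigO.trans_isLittleO (.of_bound M ?_) hsq
  filter_upwards [self_mem_nhdsWithin] with w hw
  simpa [abs_of_nonneg (sq_nonneg (w - z)), mul_comm (w - z)] using H.taylor z hz w hw

theorem abs_deriv_sub_le (H : IsC11On S K M h h') {z w : ℝ} (hz : z ∈ S) (hw : w ∈ S) :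
    |h' w - h' z| ≤ 2 * M * |w - z| := by
  rcases eq_or_ne w z with rfl | hne
  · simp
  refine le_of_mul_le_mul_right ?_ (abs_pos.2 (sub_ne_zero.2 hne))
  rw [← abs_mul, mul_assoc, ← sq, sq_abs]
  calc |(h' w - h' z) * (w - z)|
      = |(h w - h z - h' z * (w - z)) + (h z - h w - h' w * (z - w))| := by congr 1; ring
    _ ≤ M * (w - z) ^ 2 + M * (z - w) ^ 2 :=
        (abs_add_le _ _).trans (add_le_add (H.taylor z hz w hw) (H.taylor w hw z hz))
    _ = _ := by ring

theorem continuousOn_deriv (H : IsC11On S K M h h') : ContinuousOn h' S := by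
  refine (LipschitzOnWith.of_dist_le_mul (K := (2 * M).toNNReal) fun w hw z hz => ?_).continuousOn
  rw [Real.dist_eq, Real.dist_eq]
  exact (H.abs_deriv_sub_le hz hw).trans
    (mul_le_mul_of_nonneg_right (Real.le_coe_toNNReal _) (abs_nonneg _))

theorem exists_of_contDiffOn {a b : ℝ} (hab : a < b) (hh : ContDiffOn ℝ 2 h (Set.Icc a b)) :
    ∃ K M, 0 ≤ K ∧ 0 ≤ M ∧ IsC11On (Set.Icc a b) K M h (derivWithin h (Set.Icc a b)) := by
  set h' := derivWithin h (Set.Icc a b)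
  have hh' : ContDiffOn ℝ 1 h' (Set.Icc a b) :=
    hh.derivWithin (uniqueDiffOn_Icc hab) (by norm_num)
  have hderiv : ∀ z ∈ Set.Icc a b, HasDerivWithinAt h (h' z) (Set.Icc a b) z := fun z hz =>
    (hh.differentiableOn (by norm_num) z hz).hasDerivWithinAt
  obtain ⟨K, hK⟩ := isCompact_Icc.exists_bound_of_continuousOn hh'.continuousOn
  obtain ⟨M, hM⟩ := hh'.exists_lipschitzOnWith (by norm_num) (convex_Icc a b) isCompact_Icc
  have hmean : ∀ z ∈ Set.Icc a b, ∀ w ∈ Set.Icc a b, |h w - h z| ≤ K * |w - z| :=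
    fun z hz w hw => (convex_Icc a b).norm_image_sub_le_of_norm_hasDerivWithin_le hderiv hK hz hw
  refine ⟨K, M, (norm_nonneg _).trans (hK a (Set.left_mem_Icc.2 hab.le)), M.2, hmean, hK,
    fun z hz w hw => ?_⟩
  have hsub : Set.uIcc z w ⊆ Set.Icc a b := Set.uIcc_subset_Icc hz hw
  have hmean' := (convex_uIcc z w).norm_image_sub_le_of_norm_hasDerivWithin_le
    (f := fun x => h x - h' z * x) (C := M * |w - z|)
    (fun x hx => ((hderiv x (hsub hx)).mono hsub).sub ((hasDerivWithinAt_id x _).const_mul _))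
    (fun x hx => by
      rw [mul_one]
      exact (hM.dist_le_mul x (hsub hx) z hz).trans
        (mul_le_mul_of_nonneg_left (Set.abs_sub_left_of_mem_uIcc hx) M.2))
    Set.left_mem_uIcc Set.right_mem_uIcc
  calc |h w - h z - h' z * (w - z)| = |h w - h' z * w - (h z - h' z * z)| := by congr 1; ring
    _ ≤ M * |w - z| * |w - z| := hmean'
    _ = M * (w - z) ^ 2 := by rw [mul_assoc, ← sq, sq_abs]

theorem exists_ultralimit {ι : Type*} (𝓤 : Ultrafilter ι) {T : Set ℝ} (hT : IsCompact T)
    {u u' : ι → ℝ → ℝ} (H : ∀ i, IsC11On S K M (u i) (u' i)) (hu : ∀ i, Set.MapsTo (u i) S T) :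
    ∃ v v', IsC11On S K M v v' ∧ Set.MapsTo v S T ∧
      (∀ z ∈ S, Tendsto (fun i => u i z) 𝓤 (𝓝 (v z))) ∧
      ∀ z ∈ S, Tendsto (fun i => u' i z) 𝓤 (𝓝 (v' z)) := by
  obtain ⟨v, hvT, hv⟩ := exists_pointwise_ultralimit 𝓤 hT hu
  obtain ⟨v', hv'K, hv'⟩ := exists_pointwise_ultralimit 𝓤 (isCompact_Icc (a := -K) (b := K))
    fun i z hz => abs_le.1 ((H i).abs_deriv_le z hz)
  refine ⟨v, v', ⟨fun z hz w hw => ?_, fun z hz => abs_le.2 (hv'K hz), fun z hz w hw => ?_⟩,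
    hvT, hv, hv'⟩
  · exact le_of_tendsto ((hv w hw).sub (hv z hz)).abs
      (Eventually.of_forall fun i => (H i).abs_sub_le z hz w hw)
  · exact le_of_tendsto (((hv w hw).sub (hv z hz)).sub ((hv' z hz).mul_const _)).abs
      (Eventually.of_forall fun i => (H i).taylor z hz w hw)

/-- Blowing up at a critical point makes both constants small. -/
theorem rescale {ε L δ : ℝ} (H : IsC11On (Set.Icc 0 ε) K M h h') (h0 : h' 0 = 0) (hM : 0 ≤ M)
    (hδ : 0 < δ) (hL : 0 ≤ L) (hδε : L * δ ≤ ε) :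
    IsC11On (Set.Icc 0 L) (3 * M * L * δ) (M * δ) (fun x => δ⁻¹ * h (δ * x))
      fun x => h' (δ * x) := by
  have hmem : ∀ x ∈ Set.Icc 0 L, δ * x ∈ Set.Icc 0 ε := fun x hx =>
    ⟨mul_nonneg hδ.le hx.1, by nlinarith [hx.2]⟩
  have hderiv : ∀ x ∈ Set.Icc 0 L, |h' (δ * x)| ≤ 2 * M * (L * δ) := by
    intro x hx
    have hle := H.abs_deriv_sub_le (hmem 0 ⟨le_rfl, hL⟩) (hmem x hx)
    rw [mul_zero, h0, sub_zero, sub_zero, abs_of_nonneg (hmem x hx).1] at hle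
    exact hle.trans (mul_le_mul_of_nonneg_left (by nlinarith [hx.2]) (by positivity))
  have htaylor : ∀ z ∈ Set.Icc 0 L, ∀ w ∈ Set.Icc 0 L,
      |δ⁻¹ * h (δ * w) - δ⁻¹ * h (δ * z) - h' (δ * z) * (w - z)| ≤ M * δ * (w - z) ^ 2 := by
    intro z hz w hw
    have hle := H.taylor _ (hmem z hz) _ (hmem w hw)
    rw [show δ⁻¹ * h (δ * w) - δ⁻¹ * h (δ * z) - h' (δ * z) * (w - z)
      = δ⁻¹ * (h (δ * w) - h (δ * z) - h' (δ * z) * (δ * w - δ * z)) by field_simp,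
      abs_mul, abs_of_pos (inv_pos.2 hδ), inv_mul_le_iff₀ hδ]
    exact hle.trans (le_of_eq (by ring))
  refine ⟨fun z hz w hw => ?_, fun z hz => (hderiv z hz).trans ?_, htaylor⟩
  · have hwz : |w - z| ≤ L := by
      rw [abs_le]; constructor <;> linarith [hz.1, hz.2, hw.1, hw.2]
    calc |δ⁻¹ * h (δ * w) - δ⁻¹ * h (δ * z)|
        ≤ |δ⁻¹ * h (δ * w) - δ⁻¹ * h (δ * z) - h' (δ * z) * (w - z)|
          + |h' (δ * z) * (w - z)| := by
          simpa only [sub_add_cancel] using abs_add_le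
            (δ⁻¹ * h (δ * w) - δ⁻¹ * h (δ * z) - h' (δ * z) * (w - z)) (h' (δ * z) * (w - z))
      _ ≤ M * δ * (L * |w - z|) + 2 * M * (L * δ) * |w - z| := by
          rw [abs_mul]
          refine add_le_add ((htaylor z hz w hw).trans ?_) (by gcongr; exact hderiv z hz)
          rw [← sq_abs, sq]
          gcongr
      _ = _ := by ring
  · nlinarith [mul_nonneg hM (mul_nonneg hL hδ.le)]

end IsC11On

/-! ### The equation of an invariant graph -/

/-- Small data for the equation `h + G q(h) h' = η` of an invariant graph over `[c, d]`, with
unknown `h` taking values in `[a, b]`: `s` bounds `G`, `η'` and the second differences of both,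
and `Q` bounds `q`. As `G` vanishes at `c` and `d`, characteristics do not leave `[c, d]`. -/
structure SmallGraphData (c d a b s Q : ℝ) (G G' η η' q q' : ℝ → ℝ) : Prop where
  s_nonneg : 0 ≤ s
  one_le_Q : 1 ≤ Q
  small : 32 * (s * Q) ≤ 1
  isC11On_G : IsC11On (Set.Icc c d) s s G G'
  abs_G_le : ∀ z ∈ Set.Icc c d, |G z| ≤ s
  G_left : G c = 0
  G_right : G d = 0
  isC11On_η : IsC11On (Set.Icc c d) s s η η'
  mapsTo_η : Set.MapsTo η (Set.Icc c d) (Set.Icc a b)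
  isC11On_q : IsC11On (Set.Icc a b) Q Q q q'
  abs_q_le : ∀ y ∈ Set.Icc a b, |q y| ≤ Q

/-- The class of functions, preserved by time steps, in which the graph is constructed. -/
def IsCandidate (c d a b : ℝ) (h : ℝ → ℝ) : Prop :=
  (∃ h', IsC11On (Set.Icc c d) 1 1 h h') ∧ Set.MapsTo h (Set.Icc c d) (Set.Icc a b)

/-- The velocity of the base point along the graph of `h`. -/
def drift (G q h : ℝ → ℝ) (z : ℝ) : ℝ := G z * q (h z)

/-- One time step of length `τ`, explicit and along characteristics, for the evolution equation
`∂ₜ h = η - h - G q(h) h'`, whose stationary solutions are the invariant graphs. -/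
def timeStep (G η q : ℝ → ℝ) (τ : ℝ) (h : ℝ → ℝ) (z : ℝ) : ℝ :=
  (1 - τ) * h (z - τ * drift G q h z) + τ * η z

namespace SmallGraphData

variable {c d a b s Q τ e : ℝ} {G G' η η' q q' h h' k : ℝ → ℝ}
  (D : SmallGraphData c d a b s Q G G' η η' q q')
include D

theorem mul_le : s * Q ≤ 1 / 32 := by linarith [D.small]

theorem s_le : s ≤ 1 / 32 :=
  (le_mul_of_one_le_right D.s_nonneg D.one_le_Q).trans D.mul_le

theorem Q_nonneg : 0 ≤ Q := zero_le_one.trans D.one_le_Q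

theorem exists_isC11On_drift (H : IsCandidate c d a b h) :
    ∃ β', IsC11On (Set.Icc c d) (1 / 8) (1 / 8) (drift G q h) β' := by
  obtain ⟨⟨h', hh'⟩, hmaps⟩ := H
  have hcomp := D.isC11On_q.comp hh' hmaps D.Q_nonneg D.Q_nonneg
  have hmul := D.isC11On_G.mul hcomp D.abs_G_le (fun z hz => D.abs_q_le _ (hmaps hz)) D.s_nonneg
    D.s_nonneg D.s_nonneg
  exact ⟨_, hmul.mono_const (by linarith [D.small]) (by linarith [D.small])⟩

theorem abs_drift_le (H : IsCandidate c d a b h) {z : ℝ} (hz : z ∈ Set.Icc c d) :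
    |drift G q h z| ≤ 1 / 32 := by
  rw [drift, abs_mul]
  exact (mul_le_mul (D.abs_G_le z hz) (D.abs_q_le _ (H.2 hz)) (abs_nonneg _) D.s_nonneg).trans
    D.mul_le

theorem mapsTo_foot (H : IsCandidate c d a b h) (h0 : 0 ≤ τ) (h1 : τ ≤ 1) :
    Set.MapsTo (fun z => z - τ * drift G q h z) (Set.Icc c d) (Set.Icc c d) := by
  intro z hz
  obtain ⟨β', hβ⟩ := D.exists_isC11On_drift H
  have hcd : c ≤ d := hz.1.trans hz.2
  have hleft := hβ.abs_sub_le c (Set.left_mem_Icc.2 hcd) z hz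
  have hright := hβ.abs_sub_le d (Set.right_mem_Icc.2 hcd) z hz
  simp only [drift, D.G_left, D.G_right, zero_mul, sub_zero] at hleft hright
  rw [abs_of_nonneg (sub_nonneg.2 hz.1)] at hleft
  rw [abs_sub_comm, abs_of_nonneg (sub_nonneg.2 hz.2)] at hright
  have hτ : |τ * drift G q h z| ≤ |drift G q h z| := by
    rw [abs_mul, abs_of_nonneg h0]
    exact mul_le_of_le_one_left (abs_nonneg _) h1
  have hlow := abs_le.1 (hτ.trans hleft)
  have hhigh := abs_le.1 (hτ.trans hright)
  constructor <;> simp only <;> linarith [hz.1, hz.2]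

theorem isCandidate_timeStep (H : IsCandidate c d a b h) (h0 : 0 ≤ τ) (h1 : τ ≤ 1) :
    IsCandidate c d a b (timeStep G η q τ h) := by
  have h1' : 0 ≤ 1 - τ := sub_nonneg.2 h1
  refine ⟨?_, fun z hz => ?_⟩
  · obtain ⟨β', hβ⟩ := D.exists_isC11On_drift H
    obtain ⟨h', hh'⟩ := H.1
    have hfoot : IsC11On (Set.Icc c d) (1 + τ / 8) (τ / 8) (fun z => z - τ * drift G q h z)
        fun z => 1 + -τ * β' z := by
      simpa only [abs_neg, abs_of_nonneg h0, neg_mul, ← sub_eq_add_neg, zero_add,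
        mul_one_div] using (IsC11On.id _).add (hβ.const_mul (-τ))
    have hstep := ((hh'.comp hfoot (D.mapsTo_foot H h0 h1) zero_le_one zero_le_one).const_mul
      (1 - τ)).add (D.isC11On_η.const_mul τ)
    rw [abs_of_nonneg h0, abs_of_nonneg h1'] at hstep
    have hτs : τ * s ≤ τ * (1 / 32) := mul_le_mul_of_nonneg_left D.s_le h0
    exact ⟨_, hstep.mono_const (by nlinarith) (by nlinarith [pow_nonneg h0 3])⟩
  · exact convex_Icc a b (H.2 (D.mapsTo_foot H h0 h1 hz)) (D.mapsTo_η hz) h1' h0 (by ring)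

theorem abs_timeStep_sub_le (H : IsCandidate c d a b h) (Hk : IsCandidate c d a b k) (h0 : 0 ≤ τ)
    (h1 : τ ≤ 1) (he : ∀ z ∈ Set.Icc c d, |h z - k z| ≤ e) {z : ℝ} (hz : z ∈ Set.Icc c d) :
    |timeStep G η q τ h z - timeStep G η q τ k z| ≤ (1 - τ / 2) * e := by
  obtain ⟨k', hk'⟩ := Hk.1
  have he0 : 0 ≤ e := (abs_nonneg _).trans (he z hz)
  have h1' : 0 ≤ 1 - τ := sub_nonneg.2 h1
  have hzh := D.mapsTo_foot H h0 h1 hz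
  have hzk := D.mapsTo_foot Hk h0 h1 hz
  have hdrift : |drift G q h z - drift G q k z| ≤ e / 32 := by
    rw [drift, drift, ← mul_sub, abs_mul]
    calc |G z| * |q (h z) - q (k z)| ≤ s * (Q * e) := by
          refine mul_le_mul (D.abs_G_le z hz) ?_ (abs_nonneg _) D.s_nonneg
          exact (D.isC11On_q.abs_sub_le _ (Hk.2 hz) _ (H.2 hz)).trans
            (mul_le_mul_of_nonneg_left (he z hz) D.Q_nonneg)
      _ ≤ e / 32 := by nlinarith [D.mul_le]
  have hfoot : |(z - τ * drift G q h z) - (z - τ * drift G q k z)| ≤ τ * (e / 32) := by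
    rw [sub_sub_sub_cancel_left, ← mul_sub, abs_mul, abs_of_nonneg h0, abs_sub_comm]
    exact mul_le_mul_of_nonneg_left hdrift h0
  calc |timeStep G η q τ h z - timeStep G η q τ k z|
      = |(1 - τ) * ((h (z - τ * drift G q h z) - k (z - τ * drift G q h z))
          + (k (z - τ * drift G q h z) - k (z - τ * drift G q k z)))| := by
        rw [timeStep, timeStep]; congr 1; ring
    _ ≤ (1 - τ) * (e + τ * (e / 32)) := by
        rw [abs_mul, abs_of_nonneg h1']
        refine mul_le_mul_of_nonneg_left ((abs_add_le _ _).trans (add_le_add (he _ hzh) ?_)) h1'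
        exact (hk'.abs_sub_le _ hzk _ hzh).trans (by rwa [one_mul])
    _ ≤ (1 - τ / 2) * e := by nlinarith [mul_nonneg h0 he0, mul_nonneg h0 (mul_nonneg h0 he0)]

theorem isCandidate_iterate (hab : a ≤ b) (h0 : 0 ≤ τ) (h1 : τ ≤ 1) (n : ℕ) :
    IsCandidate c d a b ((timeStep G η q τ)^[n] fun _ => a) := by
  induction n with
  | zero =>
    exact ⟨⟨_, (IsC11On.const _ a).mono_const zero_le_one zero_le_one⟩,
      fun _ _ => Set.left_mem_Icc.2 hab⟩
  | succ n ih =>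
    rw [Function.iterate_succ_apply']
    exact D.isCandidate_timeStep ih h0 h1

theorem abs_iterate_succ_sub_le (hab : a ≤ b) (h0 : 0 ≤ τ) (h1 : τ ≤ 1) (n : ℕ) :
    ∀ z ∈ Set.Icc c d, |timeStep G η q τ ((timeStep G η q τ)^[n] fun _ => a) z
      - ((timeStep G η q τ)^[n] fun _ => a) z| ≤ (1 - τ / 2) ^ n * (b - a) := by
  have hcand := D.isCandidate_iterate hab h0 h1
  induction n with
  | zero =>
    intro z hz
    rw [pow_zero, one_mul]
    exact Real.dist_le_of_mem_Icc ((hcand 1).2 hz) ((hcand 0).2 hz)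
  | succ n ih =>
    intro z hz
    rw [Function.iterate_succ_apply', pow_succ', mul_assoc]
    exact D.abs_timeStep_sub_le (D.isCandidate_timeStep (hcand n) h0 h1) (hcand n) h0 h1 ih hz

theorem abs_residual_le (H : IsCandidate c d a b h) (hh' : IsC11On (Set.Icc c d) 1 1 h h')
    (h0 : 0 < τ) (h1 : τ ≤ 1) {z : ℝ} (hz : z ∈ Set.Icc c d) :
    |h z + drift G q h z * h' z - η z| ≤ |timeStep G η q τ h z - h z| / τ + τ := by
  have h1' : 0 ≤ 1 - τ := sub_nonneg.2 h1
  have hβ := D.abs_drift_le H hz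
  have htaylor := hh'.taylor z hz _ (D.mapsTo_foot H h0.le h1 hz)
  set β := drift G q h z
  set R := h (z - τ * β) - h z - h' z * ((z - τ * β) - z) with hR
  have hres : h z + β * h' z - η z
      = (-(timeStep G η q τ h z - h z) + (τ ^ 2 * (β * h' z) + (1 - τ) * R)) / τ := by
    rw [eq_div_iff h0.ne', timeStep, hR]; ring
  have hfirst : |τ ^ 2 * (β * h' z)| ≤ τ ^ 2 * (1 / 32) := by
    rw [abs_mul, abs_of_nonneg (sq_nonneg τ), abs_mul]
    refine mul_le_mul_of_nonneg_left ?_ (sq_nonneg τ)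
    simpa using mul_le_mul hβ (hh'.abs_deriv_le z hz) (abs_nonneg _) (by norm_num)
  have hsecond : |(1 - τ) * R| ≤ τ ^ 2 * (1 / 32) := by
    have hβ2 : β ^ 2 ≤ 1 / 32 := by rw [← sq_abs]; nlinarith [abs_nonneg β]
    calc |(1 - τ) * R| ≤ 1 * (1 * (z - τ * β - z) ^ 2) := by
          rw [abs_mul, abs_of_nonneg h1']
          exact mul_le_mul (by linarith) htaylor (abs_nonneg _) zero_le_one
      _ = τ ^ 2 * β ^ 2 := by ring
      _ ≤ _ := mul_le_mul_of_nonneg_left hβ2 (sq_nonneg τ)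
  rw [hres, abs_div, abs_of_pos h0, div_add' _ _ _ h0.ne']
  refine div_le_div_of_nonneg_right ((abs_add_le _ _).trans ?_) h0.le
  rw [abs_neg]
  exact add_le_add le_rfl ((abs_add_le _ _).trans (by nlinarith))

theorem exists_approx_solution (hab : a ≤ b) (he : 0 < e) :
    ∃ h h', IsC11On (Set.Icc c d) 1 1 h h' ∧ Set.MapsTo h (Set.Icc c d) (Set.Icc a b) ∧
      ∀ z ∈ Set.Icc c d, |h z + G z * q (h z) * h' z - η z| ≤ e := by
  obtain ⟨τ, h0, hτ⟩ := exists_between (lt_min (half_pos he) one_pos)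
  obtain ⟨hτe, h1⟩ := lt_min_iff.1 hτ
  have hlim : Tendsto (fun n : ℕ => (1 - τ / 2) ^ n * (b - a)) atTop (𝓝 0) := by
    simpa using (tendsto_pow_atTop_nhds_zero_of_lt_one (by linarith : 0 ≤ 1 - τ / 2)
      (by linarith)).mul_const (b - a)
  obtain ⟨n, hn⟩ :=
    (hlim.eventually (gt_mem_nhds (show 0 < τ * (e / 2) by positivity))).exists
  have H := D.isCandidate_iterate hab h0.le h1.le n
  obtain ⟨h', hh'⟩ := H.1
  refine ⟨_, h', hh', H.2, fun z hz => (D.abs_residual_le H hh' h0 h1.le hz).trans ?_⟩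
  have hstep := (D.abs_iterate_succ_sub_le hab h0.le h1.le n z hz).trans hn.le
  have hdiv := (div_le_iff₀' h0).2 hstep
  linarith

theorem exists_solution (hab : a ≤ b) :
    ∃ h h', IsC11On (Set.Icc c d) 1 1 h h' ∧ Set.MapsTo h (Set.Icc c d) (Set.Icc a b) ∧
      ∀ z ∈ Set.Icc c d, h z + G z * q (h z) * h' z = η z := by
  choose u u' hu hmaps hres using fun n : ℕ =>
    D.exists_approx_solution hab (Nat.one_div_pos_of_nat (α := ℝ) (n := n))
  obtain ⟨h, h', hh', hh, hlim, hlim'⟩ :=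
    IsC11On.exists_ultralimit (hyperfilter ℕ) isCompact_Icc hu hmaps
  refine ⟨h, h', hh', hh, fun z hz => ?_⟩
  have hq : Tendsto (fun n => q (u n z)) (hyperfilter ℕ) (𝓝 (q (h z))) :=
    (D.isC11On_q.hasDerivWithinAt (hh hz)).continuousWithinAt.tendsto.comp
      (tendsto_nhdsWithin_iff.2 ⟨hlim z hz, Eventually.of_forall fun n => hmaps n hz⟩)
  have hres_lim := (((hlim z hz).add ((hq.const_mul (G z)).mul (hlim' z hz))).sub_const (η z)).abs
  have hres_zero := squeeze_zero (fun _ => abs_nonneg _) (fun n => hres n z hz)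
    (tendsto_one_div_add_atTop_nhds_zero_nat.mono_left Nat.hyperfilter_le_atTop)
  exact sub_eq_zero.1 (abs_eq_zero.1 (tendsto_nhds_unique hres_lim hres_zero))

end SmallGraphData

/-- A `C^{1,1}` cutoff on `[0, 2]`: it equals `1` on `[0, 1]` and vanishes at `2`. -/
def cutoff (x : ℝ) : ℝ := 1 - max (x - 1) 0 ^ 2

theorem cutoff_of_le {x : ℝ} (hx : x ≤ 1) : cutoff x = 1 := by
  simp [cutoff, sub_nonpos.2 hx]

theorem abs_cutoff_le {x : ℝ} (hx : x ≤ 2) : |cutoff x| ≤ 1 := by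
  have h1 : max (x - 1) 0 ≤ 1 := max_le (by linarith) zero_le_one
  have h0 : 0 ≤ max (x - 1) 0 := le_max_right _ _
  rw [cutoff, abs_le]
  constructor <;> nlinarith

theorem isC11On_cutoff : IsC11On (Set.Icc 0 2) 2 1 cutoff fun x => -2 * max (x - 1) 0 where
  abs_sub_le z hz w hw := by
    have hz1 : max (z - 1) 0 ≤ 1 := max_le (by linarith [hz.2]) zero_le_one
    have hw1 : max (w - 1) 0 ≤ 1 := max_le (by linarith [hw.2]) zero_le_one
    have hz0 : 0 ≤ max (z - 1) 0 := le_max_right _ _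
    have hw0 : 0 ≤ max (w - 1) 0 := le_max_right _ _
    have hlip : |max (w - 1) 0 - max (z - 1) 0| ≤ |w - z| := by
      simpa using abs_max_sub_max_le_abs (w - 1) (z - 1) 0
    simp only [cutoff]
    calc |1 - max (w - 1) 0 ^ 2 - (1 - max (z - 1) 0 ^ 2)|
        = |max (w - 1) 0 + max (z - 1) 0| * |max (w - 1) 0 - max (z - 1) 0| := by
          rw [← abs_mul, ← abs_neg]; congr 1; ring
      _ ≤ 2 * |w - z| := by
          rw [abs_of_nonneg (add_nonneg hw0 hz0)]
          exact mul_le_mul (by linarith) hlip (abs_nonneg _) zero_le_two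
  abs_deriv_le z hz := by
    have hz1 : max (z - 1) 0 ≤ 1 := max_le (by linarith [hz.2]) zero_le_one
    have hz0 : 0 ≤ max (z - 1) 0 := le_max_right _ _
    rw [abs_le]; constructor <;> linarith
  taylor z _ w _ := by
    rcases le_total z 1 with hz | hz <;> rcases le_total w 1 with hw | hw <;>
      simp only [cutoff, hz, hw, sub_nonpos, sub_nonneg, max_eq_left, max_eq_right] <;>
      rw [abs_le] <;> constructor <;> nlinarith

/-! ### Existence of a local invariant graph -/

theorem hasDerivWithinAt_zero_mul_bounded {G u : ℝ → ℝ} {S : Set ℝ} {x C : ℝ}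
    (hG : HasDerivWithinAt G 0 S x) (hx : G x = 0) (hu : ∀ z ∈ S, |u z| ≤ C) :
    HasDerivWithinAt (fun z => G z * u z) 0 S x := by
  rw [hasDerivWithinAt_iff_isLittleO] at hG ⊢
  simp only [hx, zero_mul, smul_zero, sub_zero] at hG ⊢
  have hu' : u =O[𝓝[S] x] fun _ => (1 : ℝ) :=
    .of_bound C (by filter_upwards [self_mem_nhdsWithin] with z hz; simpa using hu z hz)
  simpa using hG.mul_isBigO hu'

theorem SmallGraphData.deriv_eq_zero {c d a b s Q : ℝ} {G G' η η' q q' h h' : ℝ → ℝ}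
    (D : SmallGraphData c d a b s Q G G' η η' q q') (hcd : c < d) (hG : G' c = 0) (hη : η' c = 0)
    (hh : IsC11On (Set.Icc c d) 1 1 h h') (hmaps : Set.MapsTo h (Set.Icc c d) (Set.Icc a b))
    (heq : ∀ z ∈ Set.Icc c d, h z + G z * q (h z) * h' z = η z) : h' c = 0 := by
  have hc : c ∈ Set.Icc c d := Set.left_mem_Icc.2 hcd.le
  have hbound : ∀ z ∈ Set.Icc c d, |q (h z) * h' z| ≤ Q * 1 := fun z hz => by
    rw [abs_mul]
    exact mul_le_mul (D.abs_q_le _ (hmaps hz)) (hh.abs_deriv_le z hz) (abs_nonneg _) D.Q_nonneg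
  have hproduct := hasDerivWithinAt_zero_mul_bounded (hG ▸ D.isC11On_G.hasDerivWithinAt hc)
    D.G_left hbound
  have hdiff : HasDerivWithinAt h 0 (Set.Icc c d) c := by
    have := (hη ▸ D.isC11On_η.hasDerivWithinAt hc).sub hproduct
    rw [sub_zero] at this
    exact this.congr_of_mem (fun z hz => by simp [← heq z hz, mul_assoc]) hc
  exact (uniqueDiffOn_Icc hcd c hc).eq_deriv _ (hh.hasDerivWithinAt hc) hdiff

section Rescaling

variable {ε δ r M Q Kg Kη : ℝ} {g g' η η' q q' : ℝ → ℝ}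

theorem smallGraphData_rescale (hg : IsC11On (Set.Icc 0 ε) Kg M g g') (hg0 : g 0 = 0)
    (hg'0 : g' 0 = 0) (hη : IsC11On (Set.Icc 0 ε) Kη M η η') (hη'0 : η' 0 = 0)
    (hq : IsC11On (Set.Icc (η 0 - r) (η 0 + r)) Q Q q q')
    (hqQ : ∀ y ∈ Set.Icc (η 0 - r) (η 0 + r), |q y| ≤ Q) (hM : 0 ≤ M) (hQ : 1 ≤ Q) (hδ : 0 < δ)
    (hδ1 : δ ≤ 1) (hδε : 2 * δ ≤ ε) (hδr : 4 * M * δ ≤ r) (hδQ : 544 * (M * δ * Q) ≤ 1) :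
    SmallGraphData 0 2 (η 0 - r) (η 0 + r) (17 * (M * δ)) Q
      (fun x => δ⁻¹ * g (δ * x) * cutoff x)
      (fun x => g' (δ * x) * cutoff x + δ⁻¹ * g (δ * x) * (-2 * max (x - 1) 0))
      (fun x => η (δ * x)) (fun x => δ * η' (δ * x)) q q' := by
  have hMδ : 0 ≤ M * δ := by positivity
  have hmem : ∀ x ∈ Set.Icc (0 : ℝ) 2, δ * x ∈ Set.Icc 0 ε := fun x hx =>
    ⟨mul_nonneg hδ.le hx.1, by nlinarith [hx.2]⟩
  have h0 : (0 : ℝ) ∈ Set.Icc 0 ε := by simpa using hmem 0 (by simp)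
  have hsq : ∀ x ∈ Set.Icc (0 : ℝ) 2, M * (δ * x) ^ 2 ≤ 4 * (M * δ) * δ := fun x hx => by
    nlinarith [mul_le_mul_of_nonneg_left (show x ^ 2 ≤ 4 by nlinarith [hx.1, hx.2])
      (mul_nonneg hMδ hδ.le)]
  have hg_small : ∀ x ∈ Set.Icc (0 : ℝ) 2, |δ⁻¹ * g (δ * x)| ≤ 4 * (M * δ) := fun x hx => by
    have htaylor := hg.taylor 0 h0 _ (hmem x hx)
    rw [hg0, hg'0, zero_mul, sub_zero, sub_zero, sub_zero] at htaylor
    rw [abs_mul, abs_of_pos (inv_pos.2 hδ), inv_mul_le_iff₀ hδ]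
    exact htaylor.trans ((hsq x hx).trans_eq (mul_comm _ _))
  have hη_near : ∀ x ∈ Set.Icc (0 : ℝ) 2, |η (δ * x) - η 0| ≤ r := fun x hx => by
    have htaylor := hη.taylor 0 h0 _ (hmem x hx)
    rw [hη'0, zero_mul, sub_zero, sub_zero] at htaylor
    nlinarith [hsq x hx]
  have hg_rescaled := hg.rescale hg'0 hM hδ zero_le_two hδε
  have hη_rescaled := (hη.rescale hη'0 hM hδ zero_le_two hδε).const_mul δ
  simp only [mul_inv_cancel_left₀ hδ.ne', abs_of_pos hδ] at hη_rescaled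
  have hG := hg_rescaled.mul isC11On_cutoff hg_small (fun x hx => abs_cutoff_le hx.2)
    (by positivity) (by positivity) hMδ
  exact
    { s_nonneg := by positivity
      one_le_Q := hQ
      small := by linarith
      isC11On_G := hG.mono_const (by linarith) (by linarith)
      abs_G_le := fun x hx => by
        rw [abs_mul]
        nlinarith [mul_le_mul (hg_small x hx) (abs_cutoff_le hx.2) (abs_nonneg _)
          (by positivity : 0 ≤ 4 * (M * δ))]
      G_left := by simp [hg0]
      G_right := by norm_num [cutoff]
      isC11On_η := hη_rescaled.mono_const (by nlinarith) (by nlinarith)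
      mapsTo_η := fun x hx =>
        Set.mem_Icc_iff_abs_le.1 ((abs_sub_comm _ _).trans_le (hη_near x hx))
      isC11On_q := hq
      abs_q_le := hqQ }

theorem exists_smallGraphData (hε : 0 < ε) (hr : 0 < r) (hg : ContDiffOn ℝ 2 g (Set.Icc 0 ε))
    (hη : ContDiffOn ℝ 2 η (Set.Icc 0 ε)) (hq : ContDiffOn ℝ 2 q (Set.Icc (η 0 - r) (η 0 + r)))
    (hg0 : g 0 = 0) (hg'0 : derivWithin g (Set.Icc 0 ε) 0 = 0)
    (hη'0 : derivWithin η (Set.Icc 0 ε) 0 = 0) :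
    ∃ δ s Q G' η' q', 0 < δ ∧ δ < ε ∧ G' 0 = 0 ∧ η' 0 = 0 ∧
      SmallGraphData 0 2 (η 0 - r) (η 0 + r) s Q (fun x => δ⁻¹ * g (δ * x) * cutoff x) G'
        (fun x => η (δ * x)) η' q q' := by
  obtain ⟨Kg, Mg, -, hMg, hg⟩ := IsC11On.exists_of_contDiffOn hε hg
  obtain ⟨Kη, Mη, -, -, hη⟩ := IsC11On.exists_of_contDiffOn hε hη
  obtain ⟨B, hB⟩ := isCompact_Icc.exists_bound_of_continuousOn hq.continuousOn
  obtain ⟨Kq, Mq, -, -, hq⟩ := IsC11On.exists_of_contDiffOn (by linarith) hq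
  set M := max Mg Mη
  set Q := max (max Kq Mq) (max B 1)
  have hM : 0 ≤ M := hMg.trans (le_max_left _ _)
  have hδ : ∀ᶠ δ in 𝓝[>] (0 : ℝ), 4 * M * δ < r ∧ 544 * (M * δ * Q) < 1 := by
    refine nhdsWithin_le_nhds (Filter.Eventually.and ?_ ?_)
    · exact ContinuousAt.eventually_lt (by fun_prop) continuousAt_const (by simpa using hr)
    · exact ContinuousAt.eventually_lt (by fun_prop) continuousAt_const (by simp)
  obtain ⟨δ, ⟨hδr, hδQ⟩, hδ0, hδ1⟩ :=
    (hδ.and (Ioo_mem_nhdsGT (lt_min one_pos (half_pos hε)))).exists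
  obtain ⟨hδ1, hδε⟩ := lt_min_iff.1 hδ1
  refine ⟨δ, _, Q, _, _, _, hδ0, by linarith, ?_, ?_, smallGraphData_rescale
    (hg.mono_const le_rfl (le_max_left _ _)) hg0 hg'0 (hη.mono_const le_rfl (le_max_right _ _))
    hη'0 (hq.mono_const ?_ ?_) (fun y hy => (hB y hy).trans ?_) hM ?_ hδ0 hδ1.le (by linarith)
    hδr.le hδQ.le⟩
  · simp [hg0, hg'0]
  · simp [hη'0]
  all_goals simp [Q]

theorem exists_local_invariant_graph (hε : 0 < ε) (hr : 0 < r)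
    (hg : ContDiffOn ℝ 2 g (Set.Icc 0 ε)) (hη : ContDiffOn ℝ 2 η (Set.Icc 0 ε))
    (hq : ContDiffOn ℝ 2 q (Set.Icc (η 0 - r) (η 0 + r))) (hg0 : g 0 = 0)
    (hg'0 : derivWithin g (Set.Icc 0 ε) 0 = 0) (hη'0 : derivWithin η (Set.Icc 0 ε) 0 = 0) :
    ∃ δ h h', 0 < δ ∧ δ < ε ∧ h 0 = η 0 ∧ h' 0 = 0 ∧ ContinuousOn h' (Set.Ico 0 δ) ∧
      Set.MapsTo h (Set.Ico 0 δ) (Set.Icc (η 0 - r) (η 0 + r)) ∧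
      ∀ z ∈ Set.Ico 0 δ, HasDerivWithinAt h (h' z) (Set.Ico 0 δ) z ∧
        h z + g z * q (h z) * h' z = η z := by
  obtain ⟨δ, s, Q, G', η', q', hδ, hδε, hG', hη', D⟩ :=
    exists_smallGraphData hε hr hg hη hq hg0 hg'0 hη'0
  obtain ⟨k, k', hk, hmaps, heq⟩ := D.exists_solution (by linarith)
  have hscale : Set.MapsTo (fun z => δ⁻¹ * z) (Set.Ico 0 δ) (Set.Icc 0 2) := fun z hz =>
    ⟨mul_nonneg (inv_pos.2 hδ).le hz.1, by rw [inv_mul_le_iff₀ hδ]; linarith [hz.2]⟩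
  have hh := hk.comp ((IsC11On.id _).const_mul δ⁻¹) hscale zero_le_one zero_le_one
  refine ⟨δ, fun z => k (δ⁻¹ * z), fun z => k' (δ⁻¹ * z) * (δ⁻¹ * 1), hδ, hδε, ?_, ?_,
    hh.continuousOn_deriv, hmaps.comp hscale, fun z hz => ⟨hh.hasDerivWithinAt hz, ?_⟩⟩
  · simpa [hg0] using heq 0 (by simp)
  · simp [D.deriv_eq_zero two_pos hG' hη' hk hmaps heq]
  · have hcutoff : cutoff (δ⁻¹ * z) = 1 :=
      cutoff_of_le (by rw [inv_mul_le_iff₀ hδ, mul_one]; exact hz.2.le)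
    have hkz := heq _ (hscale hz)
    simp only [mul_inv_cancel_left₀ hδ.ne', hcutoff] at hkz
    rw [← hkz]
    ring

end Rescaling

/-! ### The planar system -/

/-- The vector field of the planar system for general functions `w` (in place of `W̄`) and `g`
(in place of `f̄'`). -/
noncomputable def planarField (w g : ℝ → ℝ) (N : ℝ) (p : ℝ × ℝ) : ℝ × ℝ :=
  (-(p.1 + 1 / √6 * (w p.2 + N)) * (1 - p.1 ^ 2), √(2 / 3) * g p.2 * p.1)

/-- The properties of the functions `w` and `g` on `[0, ε]` on which the analysis of the planar
system rests. -/
structure PlanarData (w g : ℝ → ℝ) (N ε : ℝ) : Prop where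
  pos : 0 < ε
  sq_lt : N ^ 2 < 6
  contDiffOn_w : ContDiffOn ℝ 2 w (Set.Icc 0 ε)
  contDiffOn_g : ContDiffOn ℝ 2 g (Set.Icc 0 ε)
  w_zero : w 0 = 0
  g_zero : g 0 = 0
  deriv_w : derivWithin w (Set.Icc 0 ε) 0 = 0
  deriv_g : derivWithin g (Set.Icc 0 ε) 0 = 0
  g_neg : ∀ z ∈ Set.Ioc 0 ε, g z < 0

/-- The curve `y = h z`, `0 ≤ z < δ`, with `h' = dh/dz`, is invariant under the planar system,
stays off the lines `y = ±1`, and is tangent to the `z`-axis at `p_N`. -/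
structure InvariantGraph (w g : ℝ → ℝ) (N δ : ℝ) (h h' : ℝ → ℝ) : Prop where
  pos : 0 < δ
  hasDerivWithinAt : ∀ z ∈ Set.Ico 0 δ, HasDerivWithinAt h (h' z) (Set.Ico 0 δ) z
  continuousOn_deriv : ContinuousOn h' (Set.Ico 0 δ)
  zero : h 0 = -N / √6
  deriv_zero : h' 0 = 0
  abs_lt : ∀ z ∈ Set.Ico 0 δ, |h z| < 1
  invariant : ∀ z ∈ Set.Ico 0 δ,
    √(2 / 3) * g z * h z * h' z = -(h z + 1 / √6 * (w z + N)) * (1 - h z ^ 2)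

/-- The open strip `-1 < y < 1`, `0 < z < ε`. -/
abbrev strip (ε : ℝ) : Set (ℝ × ℝ) := Set.Ioo (-1) 1 ×ˢ Set.Ioo 0 ε

/-- The strip with its boundary pieces `y = 1`, `y = -1` and `z = 0`. -/
abbrev extStrip (ε : ℝ) : Set (ℝ × ℝ) := Set.Icc (-1) 1 ×ˢ Set.Ico 0 ε

theorem strip_subset_extStrip (ε : ℝ) : strip ε ⊆ extStrip ε :=
  Set.prod_mono Set.Ioo_subset_Icc_self Set.Ioo_subset_Ico_self

theorem isOpen_strip (ε : ℝ) : IsOpen (strip ε) := isOpen_Ioo.prod isOpen_Ioo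

theorem abs_neg_div_sqrt_six_lt_one {N : ℝ} (hN : N ^ 2 < 6) : |-N / √6| < 1 := by
  rw [abs_div, abs_neg, abs_of_nonneg (Real.sqrt_nonneg 6), div_lt_one (by positivity)]
  exact Real.lt_sqrt_of_sq_lt (by rwa [sq_abs])

/-! ### Uniqueness of solutions -/

theorem eq_zero_of_norm_deriv_le_mul_norm {E : Type*} [NormedAddCommGroup E] [NormedSpace ℝ E]
    {u u' : ℝ → E} {s t C : ℝ}
    (hu : ∀ τ ∈ Set.uIcc s t, HasDerivWithinAt u (u' τ) (Set.uIcc s t) τ)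
    (hbound : ∀ τ ∈ Set.uIcc s t, ‖u' τ‖ ≤ C * ‖u τ‖) (h0 : u s = 0) :
    ∀ τ ∈ Set.uIcc s t, u τ = 0 := by
  wlog hst : s ≤ t generalizing u u' s t
  · have hneg : Set.MapsTo (fun τ : ℝ => -τ) (Set.uIcc (-s) (-t)) (Set.uIcc s t) := fun τ hτ => by
      rw [Set.mem_uIcc] at hτ ⊢
      rcases hτ with h | h
      · exact .inr ⟨by linarith [h.2], by linarith [h.1]⟩
      · exact .inl ⟨by linarith [h.2], by linarith [h.1]⟩
    intro τ hτ
    have hreflected := this (u := fun τ => u (-τ)) (u' := fun τ => -u' (-τ))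
      (fun σ hσ => by
        simpa [Function.comp_def] using
          (hu _ (hneg hσ)).scomp σ (hasDerivAt_neg σ).hasDerivWithinAt hneg)
      (fun σ hσ => by rw [norm_neg]; exact hbound _ (hneg hσ)) (by simpa using h0)
      (neg_le_neg (le_of_not_ge hst)) (-τ)
      (by rw [← Set.image_neg_uIcc]; exact Set.mem_image_of_mem _ hτ)
    simpa using hreflected
  · rw [Set.uIcc_of_le hst] at *
    exact eq_zero_of_abs_deriv_le_mul_abs_self_of_eq_zero_right
      (fun τ hτ => (hu τ hτ).continuousWithinAt)
      (fun τ hτ => (hu τ (Set.Ico_subset_Icc_self hτ)).mono_of_mem_nhdsWithin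
        (Icc_mem_nhdsGE_of_mem hτ)) h0 fun τ hτ => hbound τ (Set.Ico_subset_Icc_self hτ)

theorem eqOn_of_lipschitzOnWith {E : Type*} [NormedAddCommGroup E] [NormedSpace ℝ E]
    {F : E → E} {S : Set E} {K : NNReal} (hF : LipschitzOnWith K F S) {s t : ℝ} {u v : ℝ → E}
    (hu : ∀ τ ∈ Set.uIcc s t, u τ ∈ S ∧ HasDerivWithinAt u (F (u τ)) (Set.uIcc s t) τ)
    (hv : ∀ τ ∈ Set.uIcc s t, v τ ∈ S ∧ HasDerivWithinAt v (F (v τ)) (Set.uIcc s t) τ)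
    (h : u s = v s) : Set.EqOn u v (Set.uIcc s t) := by
  intro τ hτ
  refine sub_eq_zero.1 (eq_zero_of_norm_deriv_le_mul_norm (C := K) (u := fun τ => u τ - v τ)
    (fun τ hτ => (hu τ hτ).2.sub (hv τ hτ).2) (fun τ hτ => ?_) (sub_eq_zero.2 h) τ hτ)
  rw [← dist_eq_norm, ← dist_eq_norm]
  exact hF.dist_le_mul _ (hu τ hτ).1 _ (hv τ hτ).1

namespace IsSolutionOn

variable {X : ℝ × ℝ → ℝ × ℝ} {D D' : Set (ℝ × ℝ)} {I J : Set ℝ} {γ : ℝ → ℝ × ℝ}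

theorem mono (h : IsSolutionOn X D I γ) (hD : D ⊆ D') (hJ : J ⊆ I) : IsSolutionOn X D' J γ :=
  fun τ hτ => ⟨hD (h τ (hJ hτ)).1, (h τ (hJ hτ)).2.mono hJ⟩

theorem comp_add_const (h : IsSolutionOn X D I γ) (b : ℝ) (hJ : Set.MapsTo (· + b) J I) :
    IsSolutionOn X D J fun τ => γ (τ + b) := fun τ hτ =>
  ⟨(h _ (hJ hτ)).1, by
    simpa [Function.comp_def] using
      (h _ (hJ hτ)).2.scomp τ ((hasDerivAt_id τ).add_const b).hasDerivWithinAt hJ⟩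

theorem continuousOn (h : IsSolutionOn X D I γ) : ContinuousOn γ I := fun τ hτ =>
  (h τ hτ).2.continuousWithinAt

variable {w g : ℝ → ℝ} {N τ : ℝ}

theorem hasDerivWithinAt_fst (h : IsSolutionOn (planarField w g N) D I γ) (hτ : τ ∈ I) :
    HasDerivWithinAt (fun τ => (γ τ).1)
      (-((γ τ).1 + 1 / √6 * (w (γ τ).2 + N)) * (1 - (γ τ).1 ^ 2)) I τ :=
  (ContinuousLinearMap.fst ℝ ℝ ℝ).hasFDerivAt.comp_hasDerivWithinAt τ (h τ hτ).2

theorem hasDerivWithinAt_snd (h : IsSolutionOn (planarField w g N) D I γ) (hτ : τ ∈ I) :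
    HasDerivWithinAt (fun τ => (γ τ).2) (√(2 / 3) * g (γ τ).2 * (γ τ).1) I τ :=
  (ContinuousLinearMap.snd ℝ ℝ ℝ).hasFDerivAt.comp_hasDerivWithinAt τ (h τ hτ).2

end IsSolutionOn

namespace PlanarData

variable {w g : ℝ → ℝ} {N ε : ℝ} (D : PlanarData w g N ε)
include D

theorem contDiffOn_planarField :
    ContDiffOn ℝ 2 (planarField w g N) (Set.Icc (-1) 1 ×ˢ Set.Icc 0 ε) := by
  have hw : ContDiffOn ℝ 2 (fun p : ℝ × ℝ => w p.2) (Set.Icc (-1) 1 ×ˢ Set.Icc 0 ε) :=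
    D.contDiffOn_w.comp contDiffOn_snd fun p hp => hp.2
  have hg : ContDiffOn ℝ 2 (fun p : ℝ × ℝ => g p.2) (Set.Icc (-1) 1 ×ˢ Set.Icc 0 ε) :=
    D.contDiffOn_g.comp contDiffOn_snd fun p hp => hp.2
  exact ((contDiffOn_fst.add (contDiffOn_const.mul (hw.add contDiffOn_const))).neg.mul
    (contDiffOn_const.sub (contDiffOn_fst.pow 2))).prodMk
      ((contDiffOn_const.mul hg).mul contDiffOn_fst)

theorem exists_lipschitzOnWith : ∃ K, LipschitzOnWith K (planarField w g N) (extStrip ε) := by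
  obtain ⟨K, hK⟩ := D.contDiffOn_planarField.exists_lipschitzOnWith (by norm_num)
    ((convex_Icc _ _).prod (convex_Icc _ _)) (isCompact_Icc.prod isCompact_Icc)
  exact ⟨K, hK.mono (Set.prod_mono le_rfl Set.Ico_subset_Icc_self)⟩

theorem eqOn_of_isSolutionOn {s t : ℝ} {γ₁ γ₂ : ℝ → ℝ × ℝ}
    (h₁ : IsSolutionOn (planarField w g N) (extStrip ε) (Set.uIcc s t) γ₁)
    (h₂ : IsSolutionOn (planarField w g N) (extStrip ε) (Set.uIcc s t) γ₂)
    (h : γ₁ s = γ₂ s) : Set.EqOn γ₁ γ₂ (Set.uIcc s t) :=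
  let ⟨_, hK⟩ := D.exists_lipschitzOnWith
  eqOn_of_lipschitzOnWith hK h₁ h₂ h

theorem exists_local_solution {p : ℝ × ℝ} (hp : p ∈ strip ε) {U : Set (ℝ × ℝ)} (hU : U ∈ 𝓝 p) :
    ∃ e > 0, ∃ γ : ℝ → ℝ × ℝ, γ 0 = p ∧
      IsSolutionOn (planarField w g N) (strip ε ∩ U) (Set.Icc (-e) e) γ := by
  have hstrip : strip ε ∈ 𝓝 p := (isOpen_strip ε).mem_nhds hp
  have hfield : ContDiffAt ℝ 1 (planarField w g N) p :=
    (D.contDiffOn_planarField.contDiffAt (mem_of_superset hstrip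
      (Set.prod_mono Set.Ioo_subset_Icc_self Set.Ioo_subset_Icc_self))).of_le (by norm_num)
  obtain ⟨γ, h0, e, he, hγ⟩ :=
    hfield.exists_forall_mem_closedBall_exists_eq_forall_mem_Ioo_hasDerivAt₀ 0
  have hpre : γ ⁻¹' (strip ε ∩ U) ∈ 𝓝 0 :=
    (hγ 0 (by simp [he])).continuousAt (inter_mem (by rwa [h0]) (by rwa [h0]))
  obtain ⟨d, hd, hball⟩ := Metric.mem_nhds_iff.1 hpre
  have hmin_left := min_le_left (e / 2) (d / 2)
  have hmin_right := min_le_right (e / 2) (d / 2)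
  refine ⟨min (e / 2) (d / 2), by positivity, γ, h0, fun τ hτ => ⟨hball ?_, ?_⟩⟩
  · rw [Metric.mem_ball, Real.dist_eq, sub_zero, abs_lt]
    constructor <;> linarith [hτ.1, hτ.2]
  · exact (hγ τ ⟨by linarith [hτ.1], by linarith [hτ.2]⟩).hasDerivWithinAt

end PlanarData

/-! ### Invariant graphs -/

theorem PlanarData.exists_invariantGraph {w g : ℝ → ℝ} {N ε : ℝ} (D : PlanarData w g N ε) :
    ∃ δ h h', δ < ε ∧ InvariantGraph w g N δ h h' := by
  have hy : |-N / √6| < 1 := abs_neg_div_sqrt_six_lt_one D.sq_lt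
  set r := (1 - |-N / √6|) / 2 with hr
  set η : ℝ → ℝ := fun z => -(1 / √6) * (w z + N) with hη
  have hη0 : η 0 = -N / √6 := by simp only [hη, D.w_zero]; ring
  have habs : ∀ y ∈ Set.Icc (η 0 - r) (η 0 + r), |y| < 1 := fun y hyI => by
    have hy_abs := abs_le.1 (le_refl |-N / √6|)
    rw [hη0] at hyI
    rw [abs_lt]
    constructor <;> linarith [hyI.1, hyI.2]
  have hne : ∀ y ∈ Set.Icc (η 0 - r) (η 0 + r), 1 - y ^ 2 ≠ 0 := fun y hyI =>
    (sub_pos.2 ((sq_lt_one_iff_abs_lt_one y).2 (habs y hyI))).ne'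
  have hη' : derivWithin η (Set.Icc 0 ε) 0 = 0 := by
    have hzero : (0 : ℝ) ∈ Set.Icc 0 ε := ⟨le_rfl, D.pos.le⟩
    have hw := (D.contDiffOn_w.differentiableOn two_ne_zero 0 hzero).hasDerivWithinAt
    rw [D.deriv_w] at hw
    simpa only [mul_zero] using ((hw.add_const N).const_mul (-(1 / √6))).derivWithin
      (uniqueDiffOn_Icc D.pos 0 hzero)
  obtain ⟨δ, h, h', hδ, hδε, hh0, hh'0, hcont, hmaps, hh⟩ :=
    exists_local_invariant_graph (r := r) (g := g) (q := fun y => √(2 / 3) * y / (1 - y ^ 2))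
      D.pos (by linarith) D.contDiffOn_g
      (contDiffOn_const.mul (D.contDiffOn_w.add contDiffOn_const))
      ((contDiffOn_const.mul contDiffOn_id).div
        (contDiffOn_const.sub (contDiffOn_id.pow 2)) hne)
      D.g_zero D.deriv_g hη'
  refine ⟨δ, h, h', hδε, hδ, fun z hz => (hh z hz).1, hcont, hh0.trans hη0, hh'0,
    fun z hz => habs _ (hmaps hz), fun z hz => ?_⟩
  have hz_ne := hne _ (hmaps hz)
  calc √(2 / 3) * g z * h z * h' z
      = g z * (√(2 / 3) * h z / (1 - h z ^ 2)) * h' z * (1 - h z ^ 2) := by field_simp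
    _ = (η z - h z) * (1 - h z ^ 2) := by linear_combination (1 - h z ^ 2) * (hh z hz).2
    _ = -(h z + 1 / √6 * (w z + N)) * (1 - h z ^ 2) := by simp only [hη]; ring

theorem eqOn_zero_of_hasDerivWithinAt_neg_mul {u r : ℝ → ℝ} {T : ℝ}
    (hu : ∀ τ ∈ Set.Iic T, HasDerivWithinAt u (-(r τ * u τ)) (Set.Iic T) τ)
    (hr : ∀ τ ∈ Set.Iic T, 0 ≤ r τ) (hlim : Tendsto u atBot (𝓝 0)) :
    Set.EqOn u 0 (Set.Iic T) := by
  have hanti : AntitoneOn (fun τ => u τ ^ 2) (Set.Iic T) := by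
    refine antitoneOn_of_hasDerivWithinAt_nonpos (convex_Iic T)
      (f' := fun τ => 2 * u τ * -(r τ * u τ)) (fun τ hτ => ((hu τ hτ).pow 2).continuousWithinAt)
      (fun τ hτ => (((hu τ (interior_subset hτ)).mono interior_subset).fun_pow 2).congr_deriv
        (by norm_num)) fun τ hτ => ?_
    nlinarith [mul_nonneg (hr τ (interior_subset hτ)) (sq_nonneg (u τ))]
  intro τ hτ
  have hle : u τ ^ 2 ≤ 0 := by
    refine ge_of_tendsto (by simpa using hlim.pow 2) ?_
    filter_upwards [eventually_le_atBot τ] with σ hσ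
    exact hanti (hσ.trans hτ) hτ hσ
  exact pow_eq_zero_iff two_ne_zero |>.1 (le_antisymm hle (sq_nonneg _))

namespace InvariantGraph

variable {w g h h' : ℝ → ℝ} {N ε δ T : ℝ} {γ : ℝ → ℝ × ℝ}

/-- The rate at which solutions approach an invariant graph. -/
noncomputable def rate (w g h h' : ℝ → ℝ) (N : ℝ) (p : ℝ × ℝ) : ℝ :=
  (1 - p.1 ^ 2) - (h p.2 + 1 / √6 * (w p.2 + N)) * (p.1 + h p.2) + h' p.2 * (√(2 / 3) * g p.2)

variable (H : InvariantGraph w g N δ h h')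
include H

theorem continuousOn : ContinuousOn h (Set.Ico 0 δ) := fun z hz =>
  (H.hasDerivWithinAt z hz).continuousWithinAt

theorem mono {δ' : ℝ} (h0 : 0 < δ') (hδ : δ' ≤ δ) : InvariantGraph w g N δ' h h' where
  pos := h0
  hasDerivWithinAt z hz := (H.hasDerivWithinAt z (Set.Ico_subset_Ico_right hδ hz)).mono
    (Set.Ico_subset_Ico_right hδ)
  continuousOn_deriv := H.continuousOn_deriv.mono (Set.Ico_subset_Ico_right hδ)
  zero := H.zero
  deriv_zero := H.deriv_zero
  abs_lt z hz := H.abs_lt z (Set.Ico_subset_Ico_right hδ hz)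
  invariant z hz := H.invariant z (Set.Ico_subset_Ico_right hδ hz)

theorem hasDerivWithinAt_sub {S : Set (ℝ × ℝ)} {I : Set ℝ}
    (hγ : IsSolutionOn (planarField w g N) S I γ)
    (hI : Set.MapsTo (fun τ => (γ τ).2) I (Set.Ico 0 δ)) {τ : ℝ} (hτ : τ ∈ I) :
    HasDerivWithinAt (fun τ => (γ τ).1 - h (γ τ).2)
      (-(rate w g h h' N (γ τ) * ((γ τ).1 - h (γ τ).2))) I τ := by
  have hcomp := (H.hasDerivWithinAt _ (hI hτ)).comp τ (hγ.hasDerivWithinAt_snd hτ) hI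
  refine ((hγ.hasDerivWithinAt_fst hτ).sub hcomp).congr_deriv ?_
  have hinv := H.invariant _ (hI hτ)
  simp only at hinv ⊢
  simp only [rate]
  linear_combination -hinv

variable (D : PlanarData w g N ε) (hδ : δ ≤ ε)
include D

theorem rate_pN_pos : 0 < rate w g h h' N (pN N) := by
  have hsq : (-N / √6) ^ 2 < 1 :=
    (sq_lt_one_iff_abs_lt_one _).2 (abs_neg_div_sqrt_six_lt_one D.sq_lt)
  have hcancel : -N / √6 + 1 / √6 * (0 + N) = 0 := by ring
  simp only [rate, pN, H.zero, D.w_zero, D.g_zero, hcancel]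
  linarith

include hδ

theorem continuousOn_rate : ContinuousOn (rate w g h h' N) (Set.univ ×ˢ Set.Ico 0 δ) := by
  have hsub : Set.Ico 0 δ ⊆ Set.Icc 0 ε := fun z hz => ⟨hz.1, hz.2.le.trans hδ⟩
  have hcomp : ∀ {k : ℝ → ℝ}, ContinuousOn k (Set.Ico 0 δ) →
      ContinuousOn (fun p : ℝ × ℝ => k p.2) (Set.univ ×ˢ Set.Ico 0 δ) := fun hk =>
    hk.comp continuousOn_snd fun p hp => hp.2
  have hh := hcomp H.continuousOn
  have hh' := hcomp H.continuousOn_deriv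
  have hw := hcomp (D.contDiffOn_w.continuousOn.mono hsub)
  have hg := hcomp (D.contDiffOn_g.continuousOn.mono hsub)
  exact ((continuousOn_const.sub (continuousOn_fst.pow 2)).sub
    ((hh.add (continuousOn_const.mul (hw.add continuousOn_const))).mul
      (continuousOn_fst.add hh))).add (hh'.mul (continuousOn_const.mul hg))

theorem fst_eq_of_fst_eq {s t : ℝ}
    (hγ : IsSolutionOn (planarField w g N) (extStrip ε) (Set.uIcc s t) γ)
    (hs : (γ s).1 = h (γ s).2) (hz : ∀ τ ∈ Set.uIcc s t, (γ τ).2 < δ) :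
    ∀ τ ∈ Set.uIcc s t, (γ τ).1 = h (γ τ).2 := by
  have hI : Set.MapsTo (fun τ => (γ τ).2) (Set.uIcc s t) (Set.Ico 0 δ) := fun τ hτ =>
    ⟨(hγ τ hτ).1.2.1, hz τ hτ⟩
  obtain ⟨C, hC⟩ := isCompact_uIcc.exists_bound_of_continuousOn
    ((H.continuousOn_rate D hδ).comp hγ.continuousOn fun τ hτ => ⟨trivial, hI hτ⟩)
  intro τ hτ
  refine sub_eq_zero.1 (eq_zero_of_norm_deriv_le_mul_norm (C := C)
    (fun τ hτ => H.hasDerivWithinAt_sub hγ hI hτ) (fun τ hτ => ?_) (sub_eq_zero.2 hs) τ hτ)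
  rw [norm_neg, norm_mul]
  exact mul_le_mul_of_nonneg_right (hC τ hτ) (norm_nonneg _)

theorem eventually_fst_eq (hγ : IsSolutionOn (planarField w g N) (extStrip ε) (Set.Iic T) γ)
    (hlim : Tendsto γ atBot (𝓝 (pN N))) :
    ∀ᶠ τ in atBot, (γ τ).2 < δ ∧ (γ τ).1 = h (γ τ).2 := by
  have hz : Tendsto (fun τ => (γ τ).2) atBot (𝓝 0) := (continuous_snd.tendsto _).comp hlim
  have hy : Tendsto (fun τ => (γ τ).1) atBot (𝓝 (-N / √6)) := (continuous_fst.tendsto _).comp hlim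
  have hmem : ∀ᶠ τ in atBot, (γ τ).2 ∈ Set.Ico 0 δ := by
    filter_upwards [hz.eventually (gt_mem_nhds H.pos), eventually_le_atBot T] with τ hτδ hτT
    exact ⟨(hγ τ hτT).1.2.1, hτδ⟩
  have hrate : ∀ᶠ τ in atBot, 0 < rate w g h h' N (γ τ) :=
    ((H.continuousOn_rate D hδ (pN N) ⟨trivial, le_rfl, H.pos⟩).tendsto.comp
      (tendsto_nhdsWithin_iff.2 ⟨hlim, hmem.mono fun τ hτ => ⟨trivial, hτ⟩⟩)).eventually
      (lt_mem_nhds (H.rate_pN_pos D))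
  have hdist : Tendsto (fun τ => (γ τ).1 - h (γ τ).2) atBot (𝓝 0) := by
    have hhz := (H.continuousOn 0 ⟨le_rfl, H.pos⟩).tendsto.comp
      (tendsto_nhdsWithin_iff.2 ⟨hz, hmem⟩)
    rw [H.zero] at hhz
    simpa using hy.sub hhz
  obtain ⟨T₁, hT₁⟩ := eventually_atBot.1 (hmem.and (hrate.and (eventually_le_atBot T)))
  have hsol := hγ.mono (J := Set.Iic T₁) le_rfl fun τ hτ => (hT₁ τ hτ).2.2
  have hgraph := eqOn_zero_of_hasDerivWithinAt_neg_mul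
    (fun τ hτ => H.hasDerivWithinAt_sub hsol (fun σ hσ => (hT₁ σ hσ).1) hτ)
    (fun τ hτ => (hT₁ τ hτ).2.1.le) hdist
  filter_upwards [eventually_le_atBot T₁] with τ hτ
  exact ⟨(hT₁ τ hτ).1.2, sub_eq_zero.1 (hgraph hτ)⟩

end InvariantGraph

/-! ### Local center manifolds -/

section CenterManifold

variable {V f : ℝ → ℝ} {N φ₀ δ : ℝ} {h h' : ℝ → ℝ}

theorem InvariantGraph.isLocalCenterManifold
    (D : PlanarData (Wbar V N f φ₀) (fbar f φ₀) N (f φ₀))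
    (H : InvariantGraph (Wbar V N f φ₀) (fbar f φ₀) N δ h h') (hδ : δ ≤ f φ₀) :
    IsLocalCenterManifold V N f φ₀ {p | p.2 ∈ Set.Ico 0 δ ∧ p.1 = h p.2} := by
  have hunique := uniqueDiffOn_Ico (0 : ℝ) δ
  have hderiv : ∀ z ∈ Set.Ico 0 δ, derivWithin h (Set.Ico 0 δ) z = h' z := fun z hz =>
    (H.hasDerivWithinAt z hz).derivWithin (hunique z hz)
  refine ⟨δ, h, H.pos, ?_, H.zero, (hderiv 0 ⟨le_rfl, H.pos⟩).trans H.deriv_zero, rfl, ?_, ?_⟩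
  · rw [contDiffOn_one_iff_derivWithin hunique]
    exact ⟨fun z hz => (H.hasDerivWithinAt z hz).differentiableWithinAt,
      H.continuousOn_deriv.congr hderiv⟩
  · rintro ⟨y, z⟩ ⟨hz, rfl : y = h z⟩
    exact ⟨abs_le.1 (H.abs_lt z hz).le, hz.1, hz.2.trans_le hδ⟩
  · intro γ s t hγ hs hz
    have ht : t ∈ Set.uIcc s t := Set.right_mem_uIcc
    exact ⟨⟨(hγ t ht).1.2.1, hz t ht⟩, H.fst_eq_of_fst_eq D hδ hγ hs.2 hz t ht⟩

theorem hasDerivAt_fst_eq_of_forall_mem_graph {w g : ℝ → ℝ} {a z d : ℝ} {S : Set (ℝ × ℝ)}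
    {γ : ℝ → ℝ × ℝ} (ha : 0 < a) (hγ : IsSolutionOn (planarField w g N) S (Set.Icc 0 a) γ)
    (h0 : γ 0 = (h z, z)) (hh : HasDerivAt h d z)
    (hgraph : ∀ τ ∈ Set.Icc 0 a, (γ τ).1 = h (γ τ).2) :
    √(2 / 3) * g z * h z * d = -(h z + 1 / √6 * (w z + N)) * (1 - h z ^ 2) := by
  have hzero : (0 : ℝ) ∈ Set.Icc 0 a := ⟨le_rfl, ha.le⟩
  have hsnd := hγ.hasDerivWithinAt_snd hzero
  have hcomp : HasDerivWithinAt (fun τ => h (γ τ).2) _ (Set.Icc 0 a) 0 :=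
    HasDerivAt.comp_hasDerivWithinAt 0 (by rw [h0]; exact hh) hsnd
  have hfst := (hγ.hasDerivWithinAt_fst hzero).congr_of_mem
    (fun τ hτ => (hgraph τ hτ).symm) hzero
  have heq := (uniqueDiffOn_Icc ha 0 hzero).eq_deriv _ hfst hcomp
  rw [h0] at heq
  linear_combination -heq

theorem invariance_equation_of_locally_invariant {w g : ℝ → ℝ} {ε z d : ℝ}
    (D : PlanarData w g N ε) (hδ : δ ≤ ε) (hz : z ∈ Set.Ioo 0 δ) (habs : |h z| < 1)
    (hh : HasDerivAt h d z)
    (hinv : ∀ (γ : ℝ → ℝ × ℝ) (s t : ℝ),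
      IsSolutionOn (planarField w g N) (extStrip ε) (Set.uIcc s t) γ →
      (γ s).2 ∈ Set.Ico 0 δ ∧ (γ s).1 = h (γ s).2 → (∀ τ ∈ Set.uIcc s t, (γ τ).2 < δ) →
      (γ t).1 = h (γ t).2) :
    √(2 / 3) * g z * h z * d = -(h z + 1 / √6 * (w z + N)) * (1 - h z ^ 2) := by
  have hmem : (h z, z) ∈ strip ε := ⟨abs_lt.1 habs, hz.1, hz.2.trans_le hδ⟩
  obtain ⟨a, ha, γ, h0, hγ⟩ := D.exists_local_solution hmem
    (U := Set.univ ×ˢ Set.Iio δ) ((isOpen_univ.prod isOpen_Iio).mem_nhds ⟨trivial, hz.2⟩)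
  have hsol := hγ.mono le_rfl (Set.Icc_subset_Icc (neg_nonpos.2 ha.le) le_rfl)
  refine hasDerivAt_fst_eq_of_forall_mem_graph ha hsol h0 hh fun τ hτ => ?_
  have hsub : Set.uIcc 0 τ ⊆ Set.Icc 0 a := by
    rw [Set.uIcc_of_le hτ.1]
    exact Set.Icc_subset_Icc_right hτ.2
  refine hinv γ 0 τ (hsol.mono (Set.inter_subset_left.trans (strip_subset_extStrip _)) hsub) ?_
    fun σ hσ => (hsol σ (hsub hσ)).1.2.2
  rw [h0]
  exact ⟨Set.Ioo_subset_Ico_self hz, rfl⟩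

theorem IsLocalCenterManifold.exists_invariantGraph
    (D : PlanarData (Wbar V N f φ₀) (fbar f φ₀) N (f φ₀)) {M : Set (ℝ × ℝ)}
    (hM : IsLocalCenterManifold V N f φ₀ M) :
    ∃ δ h h', δ ≤ f φ₀ ∧ InvariantGraph (Wbar V N f φ₀) (fbar f φ₀) N δ h h' ∧
      ∀ p : ℝ × ℝ, p.2 ∈ Set.Ico 0 δ → p.1 = h p.2 → p ∈ M := by
  obtain ⟨δ, h, hδ, hC, h0, hd0, rfl, hsub, hinv⟩ := hM
  have hδε : δ ≤ f φ₀ := by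
    by_contra! hlt
    have hmem : (h (f φ₀), f φ₀) ∈ extPhaseSpace f φ₀ := hsub ⟨⟨D.pos.le, hlt⟩, rfl⟩
    exact lt_irrefl _ hmem.2.2
  have hlt_one : ∀ᶠ z in 𝓝[Set.Ico 0 δ] 0, |h z| < 1 :=
    (hC.continuousOn 0 ⟨le_rfl, hδ⟩).abs.tendsto.eventually
      (gt_mem_nhds (by rw [h0]; exact abs_neg_div_sqrt_six_lt_one D.sq_lt))
  obtain ⟨e, he, hball⟩ := Metric.mem_nhdsWithin_iff.1 hlt_one
  have hshrink : Set.Ico 0 (min δ e) ⊆ Set.Ico 0 δ := Set.Ico_subset_Ico_right (min_le_left _ _)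
  have habs : ∀ z ∈ Set.Ico 0 (min δ e), |h z| < 1 := fun z hz => by
    refine hball ⟨?_, hshrink hz⟩
    rw [Metric.mem_ball, Real.dist_eq, sub_zero, abs_of_nonneg hz.1]
    exact hz.2.trans_le (min_le_right _ _)
  rw [contDiffOn_one_iff_derivWithin (uniqueDiffOn_Ico 0 δ)] at hC
  have hderiv : ∀ z ∈ Set.Ico 0 δ,
      HasDerivWithinAt h (derivWithin h (Set.Ico 0 δ) z) (Set.Ico 0 δ) z := fun z hz =>
    (hC.1 z hz).hasDerivWithinAt
  refine ⟨min δ e, h, derivWithin h (Set.Ico 0 δ), (min_le_left _ _).trans hδε,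
    ⟨lt_min hδ he, fun z hz => (hderiv z (hshrink hz)).mono hshrink, hC.2.mono hshrink, h0, hd0,
      habs, fun z hz => ?_⟩, fun p hz hy => ⟨hshrink hz, hy⟩⟩
  rcases hz.1.eq_or_lt with rfl | hzpos
  · rw [D.g_zero, D.w_zero, h0]
    ring
  have hzδ := (hshrink hz).2
  exact invariance_equation_of_locally_invariant D hδε ⟨hzpos, hzδ⟩ (habs z hz)
    ((hderiv z (hshrink hz)).hasDerivAt (Ico_mem_nhds hzpos hzδ))
    fun γ s t hγ hs hlt => (hinv γ s t hγ hs hlt).2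

end CenterManifold

/-! ### Orbits -/

theorem IsSolutionOn.union {X : ℝ × ℝ → ℝ × ℝ} {D : Set (ℝ × ℝ)} {I J : Set ℝ} {γ : ℝ → ℝ × ℝ}
    (hI : IsClosed I) (hJ : IsClosed J) (h₁ : IsSolutionOn X D I γ) (h₂ : IsSolutionOn X D J γ) :
    IsSolutionOn X D (I ∪ J) γ := by
  have hderiv : ∀ {K : Set ℝ}, IsClosed K → IsSolutionOn X D K γ → ∀ τ,
      HasDerivWithinAt γ (X (γ τ)) K τ := fun {K} hK h τ => by
    by_cases hτ : τ ∈ K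
    · exact (h τ hτ).2
    · exact HasFDerivWithinAt.of_notMem_closure (by rwa [hK.closure_eq])
  exact fun τ hτ => ⟨hτ.elim (fun h => (h₁ τ h).1) fun h => (h₂ τ h).1,
    (hderiv hI h₁ τ).union (hderiv hJ h₂ τ)⟩

/-- `p` and `q` lie on one solution in `D`. -/
def Joined (X : ℝ × ℝ → ℝ × ℝ) (D : Set (ℝ × ℝ)) (p q : ℝ × ℝ) : Prop :=
  ∃ (γ : ℝ → ℝ × ℝ) (s t : ℝ), IsSolutionOn X D (Set.uIcc s t) γ ∧ γ s = p ∧ γ t = q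

namespace Joined

variable {X : ℝ × ℝ → ℝ × ℝ} {D : Set (ℝ × ℝ)} {p q r : ℝ × ℝ} {γ₁ γ₂ : ℝ → ℝ × ℝ} {a b : ℝ}

theorem symm (h : Joined X D p q) : Joined X D q p := by
  obtain ⟨γ, s, t, hγ, hs, ht⟩ := h
  exact ⟨γ, t, s, by rwa [Set.uIcc_comm], ht, hs⟩

theorem right_mem (h : Joined X D p q) : q ∈ D := by
  obtain ⟨γ, s, t, hγ, -, rfl⟩ := h
  exact (hγ t Set.right_mem_uIcc).1

theorem exists_solution_from_zero (h : Joined X D p q) :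
    ∃ (γ : ℝ → ℝ × ℝ) (t : ℝ), IsSolutionOn X D (Set.uIcc 0 t) γ ∧ γ 0 = p ∧ γ t = q := by
  obtain ⟨γ, s, t, hγ, rfl, rfl⟩ := h
  refine ⟨fun τ => γ (τ + s), t - s, hγ.comp_add_const s fun τ hτ => ?_, by simp, by simp⟩
  rw [Set.mem_uIcc] at hτ ⊢
  rcases hτ with hτ | hτ
  · exact .inl ⟨by linarith [hτ.1], by linarith [hτ.2]⟩
  · exact .inr ⟨by linarith [hτ.1], by linarith [hτ.2]⟩

theorem of_isSolutionOn_nonpos_nonneg (ha : a ≤ 0) (hb : 0 ≤ b)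
    (h₁ : IsSolutionOn X D (Set.uIcc 0 a) γ₁) (h₂ : IsSolutionOn X D (Set.uIcc 0 b) γ₂)
    (h : γ₁ 0 = γ₂ 0) : Joined X D (γ₁ a) (γ₂ b) := by
  rw [Set.uIcc_of_ge ha] at h₁
  rw [Set.uIcc_of_le hb] at h₂
  set γ : ℝ → ℝ × ℝ := fun τ => if τ ≤ 0 then γ₁ τ else γ₂ τ
  have heq₁ : ∀ τ ∈ Set.Icc a 0, γ τ = γ₁ τ := fun τ hτ => if_pos hτ.2
  have heq₂ : ∀ τ ∈ Set.Icc 0 b, γ τ = γ₂ τ := fun τ hτ => by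
    rcases hτ.1.eq_or_lt with rfl | hlt
    · exact (if_pos le_rfl).trans h
    · exact if_neg hlt.not_ge
  have hsol₁ : IsSolutionOn X D (Set.Icc a 0) γ := fun τ hτ => by
    rw [heq₁ τ hτ]
    exact ⟨(h₁ τ hτ).1, (h₁ τ hτ).2.congr_of_mem heq₁ hτ⟩
  have hsol₂ : IsSolutionOn X D (Set.Icc 0 b) γ := fun τ hτ => by
    rw [heq₂ τ hτ]
    exact ⟨(h₂ τ hτ).1, (h₂ τ hτ).2.congr_of_mem heq₂ hτ⟩
  refine ⟨γ, a, b, ?_, heq₁ a ⟨le_rfl, ha⟩, heq₂ b ⟨hb, le_rfl⟩⟩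
  rw [Set.uIcc_of_le (ha.trans hb), ← Set.Icc_union_Icc_eq_Icc ha hb]
  exact hsol₁.union isClosed_Icc isClosed_Icc hsol₂

theorem of_isSolutionOn_of_mem_uIcc {K : NNReal} (hX : LipschitzOnWith K X D)
    (h₁ : IsSolutionOn X D (Set.uIcc 0 a) γ₁) (h₂ : IsSolutionOn X D (Set.uIcc 0 b) γ₂)
    (h : γ₁ 0 = γ₂ 0) (hab : a ∈ Set.uIcc 0 b) : Joined X D (γ₁ a) (γ₂ b) :=
  have heq := eqOn_of_lipschitzOnWith hX h₁ (h₂.mono le_rfl (Set.uIcc_subset_uIcc_left hab)) h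
    Set.right_mem_uIcc
  ⟨γ₂, a, b, h₂.mono le_rfl (Set.uIcc_subset_uIcc_right hab), heq.symm, rfl⟩

theorem trans {K : NNReal} (hX : LipschitzOnWith K X D) (h₁ : Joined X D p q)
    (h₂ : Joined X D q r) : Joined X D p r := by
  obtain ⟨γ₁, a, hγ₁, hq₁, rfl⟩ := h₁.symm.exists_solution_from_zero
  obtain ⟨γ₂, b, hγ₂, hq₂, rfl⟩ := h₂.exists_solution_from_zero
  have h : γ₁ 0 = γ₂ 0 := hq₁.trans hq₂.symm
  by_cases hab : a ∈ Set.uIcc 0 b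
  · exact of_isSolutionOn_of_mem_uIcc hX hγ₁ hγ₂ h hab
  by_cases hba : b ∈ Set.uIcc 0 a
  · exact (of_isSolutionOn_of_mem_uIcc hX hγ₂ hγ₁ h.symm hba).symm
  rcases le_total a 0 with ha | ha <;> rcases le_total b 0 with hb | hb
  · rcases le_total a b with hle | hle
    · exact absurd (Set.mem_uIcc.2 (.inr ⟨hle, hb⟩)) hba
    · exact absurd (Set.mem_uIcc.2 (.inr ⟨hle, ha⟩)) hab
  · exact of_isSolutionOn_nonpos_nonneg ha hb hγ₁ hγ₂ h
  · exact (of_isSolutionOn_nonpos_nonneg hb ha hγ₂ hγ₁ h.symm).symm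
  · rcases le_total a b with hle | hle
    · exact absurd (Set.mem_uIcc.2 (.inl ⟨ha, hle⟩)) hab
    · exact absurd (Set.mem_uIcc.2 (.inl ⟨hb, hle⟩)) hba

end Joined

theorem isSolutionOn_const {X : ℝ × ℝ → ℝ × ℝ} {D : Set (ℝ × ℝ)} (I : Set ℝ) {p : ℝ × ℝ}
    (hp : p ∈ D) (h : X p = 0) : IsSolutionOn X D I fun _ => p := fun τ _ =>
  ⟨hp, by rw [h]; exact hasDerivWithinAt_const τ I p⟩

theorem sqrt_two_thirds_le_one : √(2 / 3 : ℝ) ≤ 1 := Real.sqrt_le_one.2 (by norm_num)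

namespace PlanarData

variable {w g : ℝ → ℝ} {N ε T : ℝ} {γ : ℝ → ℝ × ℝ} (D : PlanarData w g N ε)
include D

theorem joined_trans {p q r : ℝ × ℝ} (h₁ : Joined (planarField w g N) (strip ε) p q)
    (h₂ : Joined (planarField w g N) (strip ε) q r) :
    Joined (planarField w g N) (strip ε) p r :=
  let ⟨_, hK⟩ := D.exists_lipschitzOnWith
  h₁.trans (hK.mono (strip_subset_extStrip ε)) h₂

theorem exists_norm_snd_planarField_le :
    ∃ C > 0, ∀ p ∈ extStrip ε, ‖(planarField w g N p).2‖ ≤ C * ‖p.2‖ := by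
  obtain ⟨K, hK⟩ := D.contDiffOn_g.exists_lipschitzOnWith (by norm_num) (convex_Icc _ _)
    isCompact_Icc
  refine ⟨K + 1, by positivity, fun p hp => ?_⟩
  have hg := hK.dist_le_mul p.2 ⟨hp.2.1, hp.2.2.le⟩ 0 ⟨le_rfl, D.pos.le⟩
  rw [D.g_zero, dist_zero_right, dist_zero_right] at hg
  have hy : ‖p.1‖ ≤ 1 := abs_le.2 hp.1
  have hsqrt : ‖√(2 / 3)‖ ≤ 1 := by
    rw [Real.norm_of_nonneg (Real.sqrt_nonneg _)]
    exact sqrt_two_thirds_le_one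
  calc ‖√(2 / 3) * g p.2 * p.1‖
      = ‖√(2 / 3)‖ * ‖g p.2‖ * ‖p.1‖ := by rw [norm_mul, norm_mul]
    _ ≤ 1 * (K * ‖p.2‖) * 1 := by gcongr
    _ ≤ (K + 1) * ‖p.2‖ := by linarith [norm_nonneg p.2]

theorem snd_eq_zero_of_snd_eq_zero {s t : ℝ}
    (hγ : IsSolutionOn (planarField w g N) (extStrip ε) (Set.uIcc s t) γ) (hs : (γ s).2 = 0) :
    (γ t).2 = 0 := by
  obtain ⟨C, -, hC⟩ := D.exists_norm_snd_planarField_le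
  exact eq_zero_of_norm_deriv_le_mul_norm (fun τ hτ => hγ.hasDerivWithinAt_snd hτ)
    (fun τ hτ => hC _ (hγ τ hτ).1) hs t Set.right_mem_uIcc

theorem one_sub_fst_sq_eq_zero_of_one_sub_fst_sq_eq_zero {s t : ℝ}
    (hγ : IsSolutionOn (planarField w g N) (extStrip ε) (Set.uIcc s t) γ)
    (hs : 1 - (γ s).1 ^ 2 = 0) : 1 - (γ t).1 ^ 2 = 0 := by
  have hw : ContinuousOn (fun τ => w (γ τ).2) (Set.uIcc s t) :=
    D.contDiffOn_w.continuousOn.comp (continuous_snd.comp_continuousOn hγ.continuousOn)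
      fun τ hτ => Set.Ico_subset_Icc_self (hγ τ hτ).1.2
  have hy : ContinuousOn (fun τ => (γ τ).1) (Set.uIcc s t) :=
    continuous_fst.comp_continuousOn hγ.continuousOn
  have hrate : ContinuousOn (fun τ => 2 * ((γ τ).1 * ((γ τ).1 + 1 / √6 * (w (γ τ).2 + N))))
      (Set.uIcc s t) :=
    continuousOn_const.mul (hy.mul (hy.add (continuousOn_const.mul (hw.add continuousOn_const))))
  obtain ⟨C, hC⟩ := isCompact_uIcc.exists_bound_of_continuousOn hrate
  refine eq_zero_of_norm_deriv_le_mul_norm (C := C) (u := fun τ => 1 - (γ τ).1 ^ 2)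
    (u' := fun τ => 2 * ((γ τ).1 * ((γ τ).1 + 1 / √6 * (w (γ τ).2 + N))) * (1 - (γ τ).1 ^ 2))
    (fun τ hτ => ?_) (fun τ hτ => ?_) hs t Set.right_mem_uIcc
  · refine (((hγ.hasDerivWithinAt_fst hτ).fun_pow 2).const_sub 1).congr_deriv ?_
    push_cast
    ring
  · rw [norm_mul]
    exact mul_le_mul_of_nonneg_right (hC τ hτ) (norm_nonneg _)

theorem planarField_pN : planarField w g N (pN N) = 0 := by
  simp only [planarField, pN, D.w_zero, D.g_zero]
  ext <;> simp only [Prod.fst_zero, Prod.snd_zero] <;> ring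

theorem eq_of_planarField_eq_zero
    (hγ : IsSolutionOn (planarField w g N) (extStrip ε) (Set.Iic T) γ) {τ : ℝ} (hτ : τ ≤ T)
    (h0 : planarField w g N (γ τ) = 0) : ∀ σ ≤ T, γ σ = γ τ := fun _ hσ =>
  D.eqOn_of_isSolutionOn (hγ.mono le_rfl fun _ hρ => hρ.2.trans (max_le hτ hσ))
    (isSolutionOn_const _ (hγ τ hτ).1 h0) rfl Set.right_mem_uIcc

theorem eq_pN_of_snd_eq_zero (hγ : IsSolutionOn (planarField w g N) (extStrip ε) (Set.Iic T) γ)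
    (hlim : Tendsto γ atBot (𝓝 (pN N))) (h0 : ∃ τ ≤ T, (γ τ).2 = 0) :
    ∀ τ ≤ T, γ τ = pN N := by
  obtain ⟨τ₀, hτ₀, h0⟩ := h0
  have hz : ∀ τ ≤ T, (γ τ).2 = 0 := fun τ hτ => D.snd_eq_zero_of_snd_eq_zero
    (hγ.mono le_rfl fun σ hσ => hσ.2.trans (max_le hτ₀ hτ)) h0
  obtain ⟨δ, h, h', hδ, H⟩ := D.exists_invariantGraph
  obtain ⟨τ₁, ⟨-, hy⟩, hτ₁⟩ :=
    ((H.eventually_fst_eq D hδ.le hγ hlim).and (eventually_le_atBot T)).exists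
  rw [hz τ₁ hτ₁, H.zero] at hy
  have hγτ₁ : γ τ₁ = pN N := Prod.ext hy (hz τ₁ hτ₁)
  rw [← hγτ₁]
  exact D.eq_of_planarField_eq_zero hγ hτ₁ (by rw [hγτ₁, D.planarField_pN])

theorem one_sub_fst_sq_ne_zero
    (hγ : IsSolutionOn (planarField w g N) (extStrip ε) (Set.Iic T) γ)
    (hlim : Tendsto γ atBot (𝓝 (pN N))) {τ : ℝ} (hτ : τ ≤ T) : 1 - (γ τ).1 ^ 2 ≠ 0 := by
  intro h0
  have hlim_sq : Tendsto (fun τ => 1 - (γ τ).1 ^ 2) atBot (𝓝 (1 - (-N / √6) ^ 2)) :=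
    (((continuous_fst.tendsto _).comp hlim).pow 2).const_sub 1
  have hpos : 0 < 1 - (-N / √6) ^ 2 :=
    sub_pos.2 ((sq_lt_one_iff_abs_lt_one _).2 (abs_neg_div_sqrt_six_lt_one D.sq_lt))
  obtain ⟨σ, hσ_pos, hσ⟩ :=
    ((hlim_sq.eventually (lt_mem_nhds hpos)).and (eventually_le_atBot T)).exists
  exact hσ_pos.ne' (D.one_sub_fst_sq_eq_zero_of_one_sub_fst_sq_eq_zero
    (hγ.mono le_rfl fun τ hτ' => hτ'.2.trans (max_le hτ hσ)) h0)

theorem isSolutionOn_strip_or_eq_pN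
    (hγ : IsSolutionOn (planarField w g N) (extStrip ε) (Set.Iic T) γ)
    (hlim : Tendsto γ atBot (𝓝 (pN N))) :
    IsSolutionOn (planarField w g N) (strip ε) (Set.Iic T) γ ∨ ∀ τ ≤ T, γ τ = pN N := by
  by_cases h0 : ∃ τ ≤ T, (γ τ).2 = 0
  · exact .inr (D.eq_pN_of_snd_eq_zero hγ hlim h0)
  push Not at h0
  refine .inl fun τ hτ => ⟨⟨?_, lt_of_le_of_ne (hγ τ hτ).1.2.1 (h0 τ hτ).symm, (hγ τ hτ).1.2.2⟩,
    (hγ τ hτ).2⟩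
  have hsq := D.one_sub_fst_sq_ne_zero hγ hlim hτ
  have hy : |(γ τ).1| ≠ 1 := fun h => hsq (by rw [← sq_abs, h, one_pow, sub_self])
  exact abs_lt.1 (lt_of_le_of_ne (abs_le.2 (hγ τ hτ).1.1) hy)

end PlanarData

/-! ### The monotone quantity `log K²` -/

theorem exists_hasDerivAt_of_continuousOn {I : Set ℝ} (hI : IsOpen I) (hc : I.OrdConnected)
    {k : ℝ → ℝ} (hk : ContinuousOn k I) : ∃ θ : ℝ → ℝ, ∀ t ∈ I, HasDerivAt θ (k t) t := by
  rcases I.eq_empty_or_nonempty with rfl | ⟨a, ha⟩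
  · exact ⟨k, fun t ht => ht.elim⟩
  · exact ⟨fun t => ∫ x in a..t, k x, fun t ht => intervalIntegral.integral_hasDerivAt_right
      (hk.mono (hc.uIcc_subset ha ht)).intervalIntegrable
      (hk.stronglyMeasurableAtFilter hI t ht) (hk.continuousAt (hI.mem_nhds ht))⟩

theorem sqrt_two_thirds : √(2 / 3 : ℝ) = 2 * (1 / √6) := by
  rw [mul_one_div, eq_div_iff (by positivity), ← Real.sqrt_mul (by norm_num),
    show (2 / 3 * 6 : ℝ) = 2 ^ 2 by norm_num, Real.sqrt_sq zero_le_two]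

/-- `log K²` up to an additive constant, when `P' = (w + N) / g`. -/
noncomputable def logEnergy (P : ℝ → ℝ) (p : ℝ × ℝ) : ℝ := P p.2 - Real.log (1 - p.1 ^ 2)

namespace PlanarData

variable {w g P : ℝ → ℝ} {N ε s t : ℝ} {γ : ℝ → ℝ × ℝ} (D : PlanarData w g N ε)
include D

theorem exists_primitive :
    ∃ P : ℝ → ℝ, ∀ z ∈ Set.Ioo 0 ε, HasDerivAt P ((w z + N) / g z) z := by
  have hcont : ContinuousOn (fun z => (w z + N) / g z) (Set.Ioo 0 ε) :=
    ((D.contDiffOn_w.continuousOn.mono Set.Ioo_subset_Icc_self).add continuousOn_const).div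
      (D.contDiffOn_g.continuousOn.mono Set.Ioo_subset_Icc_self)
      fun z hz => (D.g_neg z ⟨hz.1, hz.2.le⟩).ne
  exact exists_hasDerivAt_of_continuousOn isOpen_Ioo Set.ordConnected_Ioo hcont

variable (hP : ∀ z ∈ Set.Ioo 0 ε, HasDerivAt P ((w z + N) / g z) z)
include hP

theorem logEnergy_le_of_le (hγ : IsSolutionOn (planarField w g N) (strip ε) (Set.uIcc s t) γ)
    (hst : s ≤ t) : logEnergy P (γ t) ≤ logEnergy P (γ s) := by
  rw [Set.uIcc_of_le hst] at hγ
  have hderiv : ∀ τ ∈ Set.Icc s t,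
      HasDerivWithinAt (fun τ => logEnergy P (γ τ)) (-2 * (γ τ).1 ^ 2) (Set.Icc s t) τ := by
    intro τ hτ
    obtain ⟨hyI, hz⟩ := (hγ τ hτ).1
    have hy : 1 - (γ τ).1 ^ 2 ≠ 0 :=
      (sub_pos.2 ((sq_lt_one_iff_abs_lt_one _).2 (abs_lt.2 hyI))).ne'
    have hg := (D.g_neg _ ⟨hz.1, hz.2.le⟩).ne
    refine (((hP _ hz).comp_hasDerivWithinAt τ (hγ.hasDerivWithinAt_snd hτ)).sub
      ((((hγ.hasDerivWithinAt_fst hτ).fun_pow 2).const_sub 1).log hy)).congr_deriv ?_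
    rw [sqrt_two_thirds]
    field_simp
    push_cast
    ring
  refine antitoneOn_of_hasDerivWithinAt_nonpos (convex_Icc s t)
    (fun τ hτ => (hderiv τ hτ).continuousWithinAt)
    (fun τ hτ => (hderiv τ (interior_subset hτ)).mono interior_subset) (fun τ _ => ?_)
    (Set.left_mem_Icc.2 hst) (Set.right_mem_Icc.2 hst) hst
  exact mul_nonpos_of_nonpos_of_nonneg (by norm_num) (sq_nonneg _)

/-- The factor `σ` is meant to be `±1` and selects the direction of time. -/
theorem mul_logEnergy_le_of_mul_le {σ : ℝ}
    (hγ : IsSolutionOn (planarField w g N) (strip ε) (Set.uIcc s t) γ) (hst : σ * s ≤ σ * t) :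
    σ * logEnergy P (γ t) ≤ σ * logEnergy P (γ s) := by
  rcases lt_trichotomy σ 0 with hσ | rfl | hσ
  · rw [Set.uIcc_comm] at hγ
    exact mul_le_mul_of_nonpos_left
      (D.logEnergy_le_of_le hP hγ ((mul_le_mul_left_of_neg hσ).1 hst)) hσ.le
  · simp only [zero_mul, le_refl]
  · exact mul_le_mul_of_nonneg_left
      (D.logEnergy_le_of_le hP hγ ((mul_le_mul_iff_right₀ hσ).1 hst)) hσ.le

end PlanarData

/-! ### The orbit of an invariant graph without equilibria -/

theorem PlanarData.map_nhds_snd {w g : ℝ → ℝ} {N ε e : ℝ} (D : PlanarData w g N ε)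
    {γ : ℝ → ℝ × ℝ} (he : 0 < e)
    (hγ : IsSolutionOn (planarField w g N) (strip ε) (Set.Icc (-e) e) γ) (hy : (γ 0).1 ≠ 0) :
    map (fun τ => (γ τ).2) (𝓝 0) = 𝓝 (γ 0).2 := by
  have hnhds : ∀ τ ∈ Set.Ioo (-e) e, Set.Icc (-e) e ∈ 𝓝 τ := fun τ hτ => Icc_mem_nhds hτ.1 hτ.2
  have hzero : (0 : ℝ) ∈ Set.Ioo (-e) e := ⟨neg_lt_zero.2 he, he⟩
  have hz := (hγ 0 (Set.Ioo_subset_Icc_self hzero)).1.2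
  have hcont : ContinuousAt γ 0 := hγ.continuousOn.continuousAt (hnhds 0 hzero)
  have hcont_g : ContinuousAt (fun τ => g (γ τ).2) 0 :=
    ContinuousAt.comp (g := g) (D.contDiffOn_g.continuousOn.continuousAt (Icc_mem_nhds hz.1 hz.2))
      (continuous_snd.continuousAt.comp hcont)
  have hderiv : ∀ τ ∈ Set.Ioo (-e) e,
      HasDerivAt (fun τ => (γ τ).2) (√(2 / 3) * g (γ τ).2 * (γ τ).1) τ := fun τ hτ =>
    (hγ.hasDerivWithinAt_snd (Set.Ioo_subset_Icc_self hτ)).hasDerivAt (hnhds τ hτ)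
  refine (hasStrictDerivAt_of_hasDerivAt_of_continuousAt
    (eventually_of_mem (isOpen_Ioo.mem_nhds hzero) hderiv)
    ((continuousAt_const.mul hcont_g).mul (continuous_fst.continuousAt.comp hcont))).map_nhds_eq ?_
  exact mul_ne_zero (mul_ne_zero (by positivity) (D.g_neg _ ⟨hz.1, hz.2.le⟩).ne) hy

theorem eq_of_mem_uIcc_of_abs_sub_le {s τ σ : ℝ} (hσ : σ ∈ Set.uIcc s τ)
    (h : |τ - s| ≤ |σ - s|) : σ = τ := by
  have hadd := dist_add_dist_of_mem_segment (by rwa [segment_eq_uIcc] : σ ∈ segment ℝ s τ)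
  rw [← Real.dist_eq, ← Real.dist_eq, dist_comm τ, dist_comm σ] at h
  exact dist_le_zero.1 (by linarith)

theorem lt_or_exists_first_passage {z : ℝ → ℝ} {s t c : ℝ} (hz : ContinuousOn z (Set.uIcc s t))
    (hs : z s < c) : (∀ τ ∈ Set.uIcc s t, z τ < c) ∨
      ∃ τ ∈ Set.uIcc s t, z τ = c ∧ ∀ σ ∈ Set.uIcc s τ, z σ ≤ c := by
  refine or_iff_not_imp_left.2 fun hcon => ?_
  push Not at hcon
  have hcompact : IsCompact (Set.uIcc s t ∩ z ⁻¹' Set.Ici c) :=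
    isCompact_uIcc.of_isClosed_subset
      (hz.preimage_isClosed_of_isClosed isClosed_Icc isClosed_Ici) Set.inter_subset_left
  obtain ⟨τ, ⟨hτ, hcτ⟩, hmin⟩ := hcompact.exists_isMinOn hcon
    ((continuous_id.sub continuous_const).abs.continuousOn : ContinuousOn (fun σ => |σ - s|) _)
  have hfirst : ∀ σ ∈ Set.uIcc s τ, c ≤ z σ → σ = τ := fun σ hσ hle =>
    eq_of_mem_uIcc_of_abs_sub_le hσ (hmin ⟨Set.uIcc_subset_uIcc_left hτ hσ, hle⟩)
  obtain ⟨ρ, hρ, hzρ⟩ := intermediate_value_uIcc (hz.mono (Set.uIcc_subset_uIcc_left hτ))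
    (Set.mem_uIcc.2 (.inl ⟨hs.le, hcτ⟩))
  obtain rfl := hfirst ρ hρ hzρ.ge
  refine ⟨ρ, hτ, hzρ, fun σ hσ => le_of_not_gt fun hlt => ?_⟩
  rw [hfirst σ hσ hlt.le, hzρ] at hlt
  exact lt_irrefl c hlt

namespace InvariantGraph

variable {w g h h' P : ℝ → ℝ} {N ε δ σ : ℝ} (H : InvariantGraph w g N δ h h')
include H

theorem ne_zero (hne : ∀ z ∈ Set.Ioo 0 δ, w z + N ≠ 0) {z : ℝ} (hz : z ∈ Set.Ioo 0 δ) :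
    h z ≠ 0 := by
  intro h0
  have hinv := H.invariant z (Set.Ioo_subset_Ico_self hz)
  rw [h0] at hinv
  have hmul : 1 / √6 * (w z + N) = 0 := by linarith
  exact hne z hz ((mul_eq_zero.1 hmul).resolve_left (by positivity))

theorem exists_mul_neg (hne : ∀ z ∈ Set.Ioo 0 δ, h z ≠ 0) :
    ∃ σ : ℝ, ∀ z ∈ Set.Ioo 0 δ, σ * h z < 0 := by
  by_cases hneg : ∀ z ∈ Set.Ioo 0 δ, h z < 0
  · exact ⟨1, fun z hz => by rw [one_mul]; exact hneg z hz⟩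
  push Not at hneg
  obtain ⟨a, ha, hha⟩ := hneg
  refine ⟨-1, fun b hb => ?_⟩
  by_contra! hhb
  obtain ⟨c, hc, hhc⟩ := isPreconnected_Ioo.intermediate_value hb ha
    (H.continuousOn.mono Set.Ioo_subset_Ico_self) ⟨by linarith, hha⟩
  exact hne c hc hhc

theorem tendsto_logEnergy_sub (hN : N ^ 2 < 6) :
    Tendsto (fun p => logEnergy P p - logEnergy P (h p.2, p.2))
      (𝓝[Set.univ ×ˢ Set.Ico 0 δ] (pN N)) (𝓝 0) := by
  have hne : 1 - (-N / √6) ^ 2 ≠ 0 :=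
    (sub_pos.2 ((sq_lt_one_iff_abs_lt_one _).2 (abs_neg_div_sqrt_six_lt_one hN))).ne'
  have hfst : ContinuousWithinAt (fun p : ℝ × ℝ => Real.log (1 - p.1 ^ 2))
      (Set.univ ×ˢ Set.Ico 0 δ) (pN N) :=
    (continuousWithinAt_const.sub (continuousWithinAt_fst.pow 2)).log hne
  have hgraph : ContinuousWithinAt (fun p : ℝ × ℝ => Real.log (1 - h p.2 ^ 2))
      (Set.univ ×ˢ Set.Ico 0 δ) (pN N) := by
    have hcomp : ContinuousWithinAt (fun p : ℝ × ℝ => h p.2) (Set.univ ×ˢ Set.Ico 0 δ) (pN N) :=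
      (H.continuousOn 0 ⟨le_rfl, H.pos⟩).comp (t := Set.Ico 0 δ) continuousWithinAt_snd
        fun p hp => hp.2
    exact (continuousWithinAt_const.sub (hcomp.pow 2)).log
      (by simpa only [Pi.sub_apply, Pi.pow_apply, pN, H.zero] using hne)
  have hlim := (hgraph.sub hfst).tendsto
  simp only [Pi.sub_apply, pN, H.zero, sub_self] at hlim
  refine hlim.congr fun p => ?_
  simp only [logEnergy, Pi.sub_apply]
  ring

theorem mem_strip (hδ : δ ≤ ε) {z : ℝ} (hz : z ∈ Set.Ioo 0 δ) : (h z, z) ∈ strip ε :=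
  ⟨_root_.abs_lt.1 (H.abs_lt z (Set.Ioo_subset_Ico_self hz)), hz.1, hz.2.trans_le hδ⟩

variable (D : PlanarData w g N ε) (hδ : δ ≤ ε)
include D hδ

theorem joined (hne : ∀ z ∈ Set.Ioo 0 δ, h z ≠ 0)
    {z₁ z₂ : ℝ} (hz₁ : z₁ ∈ Set.Ioo 0 δ) (hz₂ : z₂ ∈ Set.Ioo 0 δ) :
    Joined (planarField w g N) (strip ε) (h z₁, z₁) (h z₂, z₂) := by
  refine isPreconnected_Ioo.induction₂
    (fun a b => Joined (planarField w g N) (strip ε) (h a, a) (h b, b))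
    (fun z hz => ?_) (fun a b c _ _ _ => D.joined_trans) (fun a b _ _ => Joined.symm) hz₁ hz₂
  refine Filter.Eventually.filter_mono nhdsWithin_le_nhds ?_
  obtain ⟨e, he, γ, h0, hγ⟩ := D.exists_local_solution (H.mem_strip hδ hz)
    (U := Set.univ ×ˢ Set.Iio δ) ((isOpen_univ.prod isOpen_Iio).mem_nhds ⟨trivial, hz.2⟩)
  have hγ_strip := hγ.mono Set.inter_subset_left le_rfl
  have hsub : ∀ {τ}, τ ∈ Set.Icc (-e) e → Set.uIcc 0 τ ⊆ Set.Icc (-e) e := fun hτ =>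
    Set.uIcc_subset_Icc ⟨by linarith, he.le⟩ hτ
  have hgraph : ∀ τ ∈ Set.Icc (-e) e, (γ τ).1 = h (γ τ).2 := fun τ hτ =>
    H.fst_eq_of_fst_eq D hδ (hγ_strip.mono (strip_subset_extStrip ε) (hsub hτ))
      (by rw [h0]) (fun σ hσ => (hγ σ (hsub hτ hσ)).1.2.2) τ Set.right_mem_uIcc
  have hmap := D.map_nhds_snd he hγ_strip (by rw [h0]; exact hne z hz)
  rw [h0] at hmap
  rw [← hmap, eventually_map]
  filter_upwards [Icc_mem_nhds (neg_lt_zero.2 he) he] with τ hτ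
  exact ⟨γ, 0, τ, hγ_strip.mono le_rfl (hsub hτ), h0, Prod.ext (hgraph τ hτ) rfl⟩

variable (hP : ∀ z ∈ Set.Ioo 0 ε, HasDerivAt P ((w z + N) / g z) z)
include hP

/-- Leaving the graph would require passing the point over `z₃`, which the monotonicity of
`log K²` forbids. -/
theorem fst_eq_of_joined {z₁ z₃ : ℝ} (h13 : z₁ < z₃) (h3 : z₃ < δ)
    (hE₃ : σ * logEnergy P (h z₃, z₃) < σ * logEnergy P (h z₁, z₁)) {p : ℝ × ℝ}
    (hp : Joined (planarField w g N) (strip ε) (h z₁, z₁) p)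
    (hEp : σ * logEnergy P (h z₁, z₁) < σ * logEnergy P p) : p.1 = h p.2 := by
  obtain ⟨γ, s, t, hγ, hs, rfl⟩ := hp
  have hts : σ * t ≤ σ * s := (le_total _ _).resolve_left fun hst =>
    absurd (D.mul_logEnergy_le_of_mul_le hP hγ hst) (not_le.2 (by rwa [hs]))
  have hγ_ext := hγ.mono (strip_subset_extStrip ε) le_rfl
  have hs_graph : (γ s).1 = h (γ s).2 := by rw [hs]
  rcases lt_or_exists_first_passage (continuous_snd.comp_continuousOn hγ.continuousOn)
    (show (γ s).2 < z₃ by rwa [hs]) with hlt | ⟨τ, hτ, hzτ, hle⟩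
  · exact H.fst_eq_of_fst_eq D hδ hγ_ext hs_graph (fun τ hτ => (hlt τ hτ).trans h3) t
      Set.right_mem_uIcc
  · have hsub : Set.uIcc s τ ⊆ Set.uIcc s t := Set.uIcc_subset_uIcc_left hτ
    have hy := H.fst_eq_of_fst_eq D hδ (hγ_ext.mono le_rfl hsub) hs_graph
      (fun σ hσ => (hle σ hσ).trans_lt h3) τ Set.right_mem_uIcc
    have hγτ : γ τ = (h z₃, z₃) := Prod.ext (hy.trans (congrArg h hzτ)) hzτ
    have hτs : σ * τ ≤ σ * s := by
      have hmem : σ * τ ∈ Set.uIcc (σ * s) (σ * t) :=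
        Set.image_const_mul_uIcc σ s t ▸ Set.mem_image_of_mem (σ * ·) hτ
      rw [Set.uIcc_of_ge hts] at hmem
      exact hmem.2
    have hE := D.mul_logEnergy_le_of_mul_le hP
      (hγ.mono le_rfl (by rwa [Set.uIcc_comm])) hτs
    rw [hs, hγτ] at hE
    exact absurd hE (not_le.2 hE₃)

theorem hasDerivAt_logEnergy {z : ℝ} (hz : z ∈ Set.Ioo 0 δ) (hne : h z ≠ 0) :
    HasDerivAt (fun z => logEnergy P (h z, z)) (-(2 * h z) / (√(2 / 3) * g z)) z := by
  have hzε : z < ε := hz.2.trans_le hδ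
  have hg := (D.g_neg z ⟨hz.1, hzε.le⟩).ne
  have hzI := Set.Ioo_subset_Ico_self hz
  have hh : HasDerivAt h (h' z) z := (H.hasDerivWithinAt z hzI).hasDerivAt (Ico_mem_nhds hz.1 hz.2)
  have hy : 1 - h z ^ 2 ≠ 0 :=
    (sub_pos.2 ((sq_lt_one_iff_abs_lt_one _).2 (H.abs_lt z hzI))).ne'
  refine ((hP z ⟨hz.1, hzε⟩).sub (((hh.fun_pow 2).const_sub 1).log hy)).congr_deriv ?_
  have hinv := H.invariant z hzI
  rw [sqrt_two_thirds] at hinv ⊢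
  have hh' : h' z = -(h z + 1 / √6 * (w z + N)) * (1 - h z ^ 2) / (2 * (1 / √6) * g z * h z) := by
    rw [eq_div_iff (by positivity)]
    linarith
  rw [hh']
  field_simp
  push_cast
  ring

theorem strictAntiOn_mul_logEnergy (hσ : ∀ z ∈ Set.Ioo 0 δ, σ * h z < 0) :
    StrictAntiOn (fun z => σ * logEnergy P (h z, z)) (Set.Ioo 0 δ) := by
  have hderiv := fun z (hz : z ∈ Set.Ioo 0 δ) =>
    (H.hasDerivAt_logEnergy D hδ hP hz (right_ne_zero_of_mul (hσ z hz).ne)).const_mul σ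
  refine strictAntiOn_of_hasDerivWithinAt_neg (convex_Ioo 0 δ)
    (fun z hz => (hderiv z hz).continuousAt.continuousWithinAt)
    (fun z hz => (hderiv z (interior_subset hz)).hasDerivWithinAt) fun z hz => ?_
  replace hz : z ∈ Set.Ioo 0 δ := interior_subset hz
  have hg := D.g_neg z ⟨hz.1, hz.2.le.trans hδ⟩
  have hsqrt : 0 < √(2 / 3 : ℝ) := by positivity
  rw [show σ * (-(2 * h z) / (√(2 / 3) * g z)) = -2 * (σ * h z) / (√(2 / 3) * g z) by ring]
  exact div_neg_of_pos_of_neg (by linarith [hσ z hz]) (mul_neg_of_pos_of_neg hsqrt hg)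

theorem eventually_mul_logEnergy_lt (hσ : ∀ z ∈ Set.Ioo 0 δ, σ * h z < 0) {z₁ : ℝ}
    (hz₁ : z₁ ∈ Set.Ioo 0 δ) : ∀ᶠ p in 𝓝 (pN N), p.2 < δ ∧
      (0 < p.2 → σ * logEnergy P (h z₁, z₁) < σ * logEnergy P p) := by
  have hanti := H.strictAntiOn_mul_logEnergy D hδ hP hσ
  have hhalf : z₁ / 2 ∈ Set.Ioo 0 δ := ⟨half_pos hz₁.1, (half_lt_self hz₁.1).trans hz₁.2⟩
  have hgap := sub_pos.2 (hanti hhalf hz₁ (half_lt_self hz₁.1))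
  have hclose := ((H.tendsto_logEnergy_sub (P := P) D.sq_lt).const_mul σ).eventually
    (lt_mem_nhds (show -_ < σ * 0 by rw [mul_zero]; exact neg_neg_of_pos hgap))
  have hsmall : ∀ᶠ p in 𝓝 (pN N), p.2 < z₁ / 2 :=
    (isOpen_lt continuous_snd continuous_const).mem_nhds hhalf.1
  filter_upwards [eventually_nhdsWithin_iff.1 hclose, hsmall] with p hpE hp
  have hpδ := hp.trans hhalf.2
  refine ⟨hpδ, fun hp0 => ?_⟩
  have hdiff := hpE ⟨trivial, hp0.le, hpδ⟩
  rw [mul_sub] at hdiff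
  linarith [hanti ⟨hp0, hpδ⟩ hhalf hp]

omit hP in
theorem exists_nhds_insert_orbit_inter_eq (hne : ∀ z ∈ Set.Ioo 0 δ, h z ≠ 0) :
    ∃ U ∈ 𝓝 (pN N), insert (pN N)
      {q | Joined (planarField w g N) (strip ε) (h (δ / 2), δ / 2) q} ∩ U
        = {p | p.2 ∈ Set.Ico 0 δ ∧ p.1 = h p.2} ∩ U := by
  obtain ⟨P, hP⟩ := D.exists_primitive
  obtain ⟨σ, hσ⟩ := H.exists_mul_neg hne
  have hδ0 := H.pos
  have hz₁ : δ / 2 ∈ Set.Ioo 0 δ := ⟨by linarith, by linarith⟩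
  have hz₃ : 3 * δ / 4 ∈ Set.Ioo 0 δ := ⟨by linarith, by linarith⟩
  have hlt : δ / 2 < 3 * δ / 4 := by linarith
  refine ⟨_, H.eventually_mul_logEnergy_lt D hδ hP hσ hz₁, Set.ext fun p => ⟨?_, ?_⟩⟩
  · rintro ⟨rfl | hp, hpU⟩
    · exact ⟨⟨⟨le_rfl, hδ0⟩, H.zero.symm⟩, hpU⟩
    · have hp0 := hp.right_mem.2.1
      have hE₃ := H.strictAntiOn_mul_logEnergy D hδ hP hσ hz₁ hz₃ hlt
      exact ⟨⟨⟨hp0.le, hpU.1⟩,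
        H.fst_eq_of_joined D hδ hP hlt hz₃.2 hE₃ hp (hpU.2 hp0)⟩, hpU⟩
  · rintro ⟨⟨hz, hy⟩, hpU⟩
    refine ⟨?_, hpU⟩
    rcases hz.1.eq_or_lt with h0 | h0
    · exact .inl (Prod.ext (by rw [hy, ← h0, H.zero]; rfl) h0.symm)
    · right
      have hj := H.joined D hδ hne hz₁ ⟨h0, hz.2⟩
      rwa [show (h p.2, p.2) = p from Prod.ext hy.symm rfl] at hj

end InvariantGraph

/-! ### Admissible coordinates -/

namespace IsAdmissibleCoordinate

variable {k : ℕ} {V f : ℝ → ℝ} {N φ₀ φ : ℝ} (hf : IsAdmissibleCoordinate k V N f φ₀)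
include hf

theorem apply_mem (hφ : φ₀ ≤ φ) : f φ ∈ Set.Ioc 0 (f φ₀) :=
  hf.onto ▸ Set.mem_image_of_mem f hφ

theorem exists_eq {z : ℝ} (hz : z ∈ Set.Ioc 0 (f φ₀)) : ∃ φ, φ₀ ≤ φ ∧ f φ = z := by
  rwa [← hf.onto] at hz

theorem map_atTop : map f atTop = 𝓝[>] 0 := by
  refine le_antisymm (tendsto_nhdsWithin_iff.2 ⟨hf.tendsto, ?_⟩) fun s hs => ?_
  · filter_upwards [eventually_ge_atTop φ₀] with φ hφ using (hf.apply_mem hφ).1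
  · have hmem : ∀ᶠ φ in atTop, f φ ∈ s := hs
    obtain ⟨Φ, hΦ⟩ := eventually_atTop.1 (hmem.and (eventually_ge_atTop φ₀))
    have hΦ₀ := (hΦ Φ le_rfl).2
    refine mem_of_superset (Ioo_mem_nhdsGT (hf.apply_mem hΦ₀).1) fun z hz => ?_
    obtain ⟨φ, hφ, rfl⟩ := hf.exists_eq ⟨hz.1, hz.2.le.trans (hf.apply_mem hΦ₀).2⟩
    exact (hΦ φ ((hf.strictAntiOn.lt_iff_gt hφ hΦ₀).1 hz.2).le).1

theorem bar_apply (q : ℝ → ℝ) (hφ : φ₀ ≤ φ) : bar f φ₀ q (f φ) = q φ := by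
  rw [bar, if_pos (hf.apply_mem hφ).1]
  exact congrArg q (hf.strictAntiOn.injOn.leftInvOn_invFunOn hφ)

theorem tendsto_bar_zero {q : ℝ → ℝ} (hq : ContinuousOn (bar f φ₀ q) (Set.Icc 0 (f φ₀))) :
    Tendsto q atTop (𝓝 (bar f φ₀ q 0)) := by
  have hf_within : Tendsto f atTop (𝓝[Set.Icc 0 (f φ₀)] 0) := by
    refine tendsto_nhdsWithin_iff.2 ⟨hf.tendsto, ?_⟩
    filter_upwards [eventually_ge_atTop φ₀] with φ hφ
      using Set.Ioc_subset_Icc_self (hf.apply_mem hφ)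
  refine ((hq 0 ⟨le_rfl, (hf.apply_mem le_rfl).1.le⟩).tendsto.comp hf_within).congr' ?_
  filter_upwards [eventually_ge_atTop φ₀] with φ hφ using hf.bar_apply q hφ

theorem hasDerivWithinAt (hφ : φ₀ ≤ φ) :
    HasDerivWithinAt f (fbar f φ₀ (f φ)) (Set.Ici φ₀) φ := by
  rw [fbar, hf.bar_apply _ hφ]
  exact (hf.contDiffOn.differentiableOn (by simp) φ hφ).hasDerivWithinAt

theorem hasDerivAt (hφ : φ₀ < φ) : HasDerivAt f (fbar f φ₀ (f φ)) φ :=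
  (hf.hasDerivWithinAt hφ.le).hasDerivAt (Ici_mem_nhds hφ)

theorem exists_fbar_eq_sub (hφ : φ₀ < φ) : ∃ ξ > φ, fbar f φ₀ (f ξ) = f (φ + 1) - f φ := by
  obtain ⟨ξ, hξ, hslope⟩ := exists_hasDerivAt_eq_slope f (fun x => fbar f φ₀ (f x))
    (lt_add_one φ)
    (fun x hx => (hf.hasDerivAt (hφ.trans_le hx.1)).continuousAt.continuousWithinAt)
    (fun x hx => hf.hasDerivAt (hφ.trans hx.1))
  exact ⟨ξ, hξ.1, by rw [hslope, add_sub_cancel_left, div_one]⟩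

-- The limit of `f'` at infinity exists, and difference quotients of `f` tend to zero.
theorem fbar_zero : fbar f φ₀ 0 = 0 := by
  have hlim := hf.tendsto_bar_zero hf.contDiffOn_fbar.continuousOn
  have hdiff : Tendsto (fun φ => f (φ + 1) - f φ) atTop (𝓝 0) := by
    simpa only [sub_self, Function.comp_apply, id_eq] using
      (hf.tendsto.comp (tendsto_atTop_add_const_right atTop 1 tendsto_id)).sub hf.tendsto
  choose! ξ hξ_gt hξ using fun φ => hf.exists_fbar_eq_sub (φ := φ)
  have hξ_atTop : Tendsto ξ atTop atTop := by
    refine tendsto_atTop_mono' atTop ?_ tendsto_id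
    filter_upwards [eventually_gt_atTop φ₀] with φ hφ using (hξ_gt φ hφ).le
  refine tendsto_nhds_unique ((hlim.comp hξ_atTop).congr' ?_) hdiff
  filter_upwards [eventually_gt_atTop φ₀] with φ hφ
  rw [← hξ φ hφ, Function.comp, fbar, hf.bar_apply _ (hφ.trans (hξ_gt φ hφ)).le]

/-- If `f'` vanished somewhere, uniqueness for `f' = f̄'(f)` would make `f` constant. -/
theorem fbar_neg (hk : k ≠ 0) {z : ℝ} (hz : z ∈ Set.Ioc 0 (f φ₀)) : fbar f φ₀ z < 0 := by
  obtain ⟨φ, hφ, rfl⟩ := hf.exists_eq hz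
  refine lt_of_le_of_ne ?_ fun h0 => ?_
  · rw [fbar, hf.bar_apply _ hφ]
    exact hf.strictAntiOn.antitoneOn.derivWithin_nonpos
  · obtain ⟨C, hC⟩ := (hf.contDiffOn_fbar.of_le
      (Nat.one_le_cast.2 (Nat.one_le_iff_ne_zero.2 hk))).exists_lipschitzOnWith one_ne_zero
      (convex_Icc _ _) isCompact_Icc
    have hle : φ ≤ φ + 1 := (lt_add_one φ).le
    have hsub : Set.uIcc φ (φ + 1) ⊆ Set.Ici φ₀ := by
      rw [Set.uIcc_of_le hle]; exact fun x hx => hφ.trans hx.1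
    have hconst := eq_zero_of_norm_deriv_le_mul_norm (C := C) (u := fun x => f x - f φ)
      (fun x hx => ((hf.hasDerivWithinAt (hsub hx)).mono hsub).sub_const _) (fun x hx => by
        have hlip := hC.dist_le_mul _ (Set.Ioc_subset_Icc_self (hf.apply_mem (hsub hx))) _
          (Set.Ioc_subset_Icc_self hz)
        rwa [h0, dist_zero_right, dist_eq_norm] at hlip) (sub_self _) _ Set.right_mem_uIcc
    exact (hf.strictAntiOn hφ (hφ.trans hle) (lt_add_one φ)).ne (sub_eq_zero.1 hconst)

theorem Wbar_add (hφ : φ₀ ≤ φ) : Wbar V N f φ₀ (f φ) + N = deriv V φ / V φ := by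
  rw [Wbar, hf.bar_apply _ hφ, W, sub_add_cancel]

theorem Wbar_add_eq_zero_iff (hφ : φ₀ ≤ φ) :
    Wbar V N f φ₀ (f φ) + N = 0 ↔ deriv V φ = 0 := by
  rw [hf.Wbar_add hφ, div_eq_zero_iff, or_iff_left (hf.V_pos φ hφ).ne']

theorem frequently_Wbar_add_eq_zero_iff :
    (∃ᶠ z in 𝓝[>] 0, Wbar V N f φ₀ z + N = 0) ↔ ∃ᶠ φ in atTop, deriv V φ = 0 := by
  rw [← hf.map_atTop, frequently_map]
  refine frequently_congr ?_
  filter_upwards [eventually_ge_atTop φ₀] with φ hφ using hf.Wbar_add_eq_zero_iff hφ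

theorem planarData (hk : 2 ≤ k) (hV : IsWBI V N) (hN : N ^ 2 < 6) :
    PlanarData (Wbar V N f φ₀) (fbar f φ₀) N (f φ₀) where
  pos := (hf.apply_mem le_rfl).1
  sq_lt := hN
  contDiffOn_w := hf.contDiffOn_Wbar.of_le (Nat.ofNat_le_cast.2 hk)
  contDiffOn_g := hf.contDiffOn_fbar.of_le (Nat.ofNat_le_cast.2 hk)
  w_zero := tendsto_nhds_unique (hf.tendsto_bar_zero hf.contDiffOn_Wbar.continuousOn) hV.2.2.2
  g_zero := hf.fbar_zero
  deriv_w := hf.deriv_Wbar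
  deriv_g := hf.deriv_fbar
  g_neg _ hz := hf.fbar_neg (by lia) hz

end IsAdmissibleCoordinate

/-! ### Past-asymptotic solutions -/

section PastAsymptotic

variable {w g h h' : ℝ → ℝ} {N ε δ T : ℝ} {γ : ℝ → ℝ × ℝ}

theorem InvariantGraph.exists_eq_of_tendsto (H : InvariantGraph w g N δ h h')
    (D : PlanarData w g N ε) (hδ : δ ≤ ε)
    (hγ : IsSolutionOn (planarField w g N) (strip ε) (Set.Iic T) γ)
    (hlim : Tendsto γ atBot (𝓝 (pN N))) :
    ∃ z₀ > 0, ∀ z ∈ Set.Ioc 0 z₀, ∃ τ ≤ T, γ τ = (h z, z) := by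
  obtain ⟨T₁, hT₁⟩ := eventually_atBot.1 ((H.eventually_fst_eq D hδ
    (hγ.mono (strip_subset_extStrip ε) le_rfl) hlim).and (eventually_le_atBot T))
  have hT : T₁ ≤ T := (hT₁ T₁ le_rfl).2
  refine ⟨(γ T₁).2, (hγ T₁ hT).1.2.1, fun z hz => ?_⟩
  have hsnd : Tendsto (fun τ => (γ τ).2) atBot (𝓝 0) := (continuous_snd.tendsto _).comp hlim
  obtain ⟨T₂, hT₂z, hT₂⟩ :=
    ((hsnd.eventually (gt_mem_nhds hz.1)).and (eventually_le_atBot T₁)).exists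
  obtain ⟨τ, hτ, rfl⟩ := intermediate_value_Icc hT₂ ((continuous_snd.comp_continuousOn
    hγ.continuousOn).mono fun τ hτ => hτ.2.trans hT) ⟨hT₂z.le, hz.2⟩
  exact ⟨τ, hτ.2.trans hT, Prod.ext (hT₁ τ hτ.2).1.2 rfl⟩

theorem PlanarData.eq_zero_of_frequently (D : PlanarData w g N ε)
    (hfreq : ∃ᶠ z in 𝓝[>] 0, w z + N = 0) : N = 0 := by
  have hw : Tendsto (fun z => w z + N) (𝓝[>] 0) (𝓝 N) := by
    have hcont := (D.contDiffOn_w.continuousOn 0 ⟨le_rfl, D.pos.le⟩).mono_of_mem_nhdsWithin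
      (Icc_mem_nhdsGT D.pos)
    simpa only [D.w_zero, zero_add] using hcont.tendsto.add_const N
  by_contra hN
  exact hfreq (hw.eventually_ne hN)

-- For `N = 0` the invariance equation reads `h (√(2/3) g h' + 1 - h²) = -w (1 - h²) / √6`,
-- where the bracket tends to `1`.
theorem InvariantGraph.eventually_eq_zero_of_eq_zero (H : InvariantGraph w g 0 δ h h')
    (hg : ContinuousOn g (Set.Ico 0 δ)) :
    ∀ᶠ z in 𝓝[>] 0, w z = 0 → h z = 0 := by
  have h0 : (0 : ℝ) ∈ Set.Ico 0 δ := ⟨le_rfl, H.pos⟩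
  have hcont : ContinuousWithinAt (fun z => √(2 / 3) * g z * h' z + (1 - h z ^ 2))
      (Set.Ico 0 δ) 0 :=
    ((continuousWithinAt_const.mul (hg 0 h0)).mul (H.continuousOn_deriv 0 h0)).add
      (continuousWithinAt_const.sub ((H.continuousOn 0 h0).pow 2))
  have hpos : ∀ᶠ z in 𝓝[Set.Ico 0 δ] 0, 0 < √(2 / 3) * g z * h' z + (1 - h z ^ 2) :=
    hcont.tendsto.eventually (lt_mem_nhds (by simp [H.zero, H.deriv_zero]))
  have hIoo : 𝓝[>] (0 : ℝ) ≤ 𝓝[Set.Ico 0 δ] 0 :=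
    nhdsWithin_le_iff.2 (mem_of_superset (Ioo_mem_nhdsGT H.pos) Set.Ioo_subset_Ico_self)
  filter_upwards [hIoo hpos, Ioo_mem_nhdsGT H.pos] with z hz hzδ hw
  have hinv := H.invariant z (Set.Ioo_subset_Ico_self hzδ)
  rw [hw, add_zero, mul_zero, add_zero] at hinv
  have hprod : h z * (√(2 / 3) * g z * h' z + (1 - h z ^ 2)) = 0 := by
    linear_combination hinv
  exact (mul_eq_zero.1 hprod).resolve_right hz.ne'

/-- The zeros of `w + N` are equilibria on the invariant graph, hence on every past-asymptotic
solution. -/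
theorem PlanarData.not_tendsto_pN_of_frequently (D : PlanarData w g N ε)
    (hfreq : ∃ᶠ z in 𝓝[>] 0, w z + N = 0)
    (hγ : IsSolutionOn (planarField w g N) (strip ε) (Set.Iic T) γ) :
    ¬ Tendsto γ atBot (𝓝 (pN N)) := by
  intro hlim
  obtain rfl := D.eq_zero_of_frequently hfreq
  obtain ⟨δ, h, h', hδ, H⟩ := D.exists_invariantGraph
  obtain ⟨z₀, hz₀, hcover⟩ := H.exists_eq_of_tendsto D hδ.le hγ hlim
  have hg : ContinuousOn g (Set.Ico 0 δ) :=
    D.contDiffOn_g.continuousOn.mono fun z hz => ⟨hz.1, (hz.2.trans hδ).le⟩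
  obtain ⟨z, hwz, hhz, hz⟩ := (hfreq.and_eventually
    ((H.eventually_eq_zero_of_eq_zero hg).and (Ioc_mem_nhdsGT hz₀))).exists
  rw [add_zero] at hwz
  obtain ⟨τ, hτ, hγτ⟩ := hcover z hz
  rw [hhz hwz] at hγτ
  have hequilibrium : planarField w g 0 (γ τ) = 0 := by simp [planarField, hγτ, hwz]
  have hconst := D.eq_of_planarField_eq_zero (hγ.mono (strip_subset_extStrip ε) le_rfl) hτ
    hequilibrium
  have hlim_const : Tendsto γ atBot (𝓝 (0, z)) := by
    refine tendsto_const_nhds.congr' ?_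
    filter_upwards [eventually_le_atBot T] with σ hσ
    rw [hconst σ hσ, hγτ]
  exact hz.1.ne (congrArg Prod.snd (tendsto_nhds_unique hlim hlim_const))

end PastAsymptotic

/-! ### Cosmologies as solutions of the planar system -/

theorem hasDerivAt_invFunOn {I : Set ℝ} (hI : IsOpen I) {θ θ' : ℝ → ℝ}
    (hθ : ∀ t ∈ I, HasDerivAt θ (θ' t) t) (hmono : StrictMonoOn θ I) {t : ℝ} (ht : t ∈ I)
    (h0 : θ' t ≠ 0) : HasDerivAt (Function.invFunOn θ I) (θ' t)⁻¹ (θ t) := by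
  have hleft : Set.LeftInvOn (Function.invFunOn θ I) θ I := hmono.injOn.leftInvOn_invFunOn
  have hnhds : θ '' I ∈ 𝓝 (θ t) := by
    obtain ⟨e, he, hsub⟩ := (nhds_basis_Icc_pos t).mem_iff.1 (hI.mem_nhds ht)
    have hIVT : Set.Icc (θ (t - e)) (θ (t + e)) ⊆ θ '' Set.Icc (t - e) (t + e) :=
      intermediate_value_Icc (by linarith)
        fun s hs => (hθ s (hsub hs)).continuousAt.continuousWithinAt
    refine mem_of_superset (Icc_mem_nhds ?_ ?_) (hIVT.trans (Set.image_mono hsub))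
    · exact hmono (hsub ⟨le_rfl, by linarith⟩) ht (by linarith)
    · exact hmono ht (hsub ⟨by linarith, le_rfl⟩) (by linarith)
  have hinv_mono : MonotoneOn (Function.invFunOn θ I) (θ '' I) := by
    rintro _ ⟨s, hs, rfl⟩ _ ⟨r, hr, rfl⟩ hle
    rwa [hleft hs, hleft hr, ← hmono.le_iff_le hs hr]
  have hcont : ContinuousAt (Function.invFunOn θ I) (θ t) := by
    refine continuousAt_of_monotoneOn_of_image_mem_nhds hinv_mono hnhds ?_
    rw [hleft.image_image, hleft ht]
    exact hI.mem_nhds ht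
  refine HasDerivAt.of_local_left_inverse hcont (by rw [hleft ht]; exact hθ t ht) h0 ?_
  filter_upwards [hnhds] with _ hτ using Function.invFunOn_eq hτ

theorem sqrt_three_halves : √(3 / 2 : ℝ) = 3 * (1 / √6) := by
  rw [mul_one_div, eq_div_iff (by positivity), ← Real.sqrt_mul (by norm_num),
    show (3 / 2 * 6 : ℝ) = 3 ^ 2 by norm_num]
  exact Real.sqrt_sq (by norm_num)

/-- The trace `(y, z)` of a cosmology in the plane of the dynamical system, as a function of
proper time. -/
noncomputable def trace (f φ ψ K : ℝ → ℝ) (t : ℝ) : ℝ × ℝ := (yCoord ψ K t, f (φ t))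

theorem OriginatesAtPN.tendsto_trace {k : ℕ} {V f φ ψ K : ℝ → ℝ} {N φ₀ : ℝ} {I : Set ℝ}
    (ho : OriginatesAtPN N I φ ψ K) (hf : IsAdmissibleCoordinate k V N f φ₀) :
    Tendsto (fun t : I => trace f φ ψ K t) atBot (𝓝 (pN N)) :=
  ho.2.prodMk_nhds (hf.tendsto.comp ho.1)

namespace IsCosmology

variable {k : ℕ} {V f : ℝ → ℝ} {N φ₀ t t₀ : ℝ} {I : Set ℝ} {φ ψ K θ : ℝ → ℝ}
  (hc : IsCosmology V I φ ψ K)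
include hc

theorem exists_primitive : ∃ θ : ℝ → ℝ, ∀ t ∈ I, HasDerivAt θ (K t) t :=
  exists_hasDerivAt_of_continuousOn hc.isOpen hc.ordConnected
    fun t ht => (hc.deriv_K t ht).continuousAt.continuousWithinAt

theorem strictMonoOn_primitive (hθ : ∀ t ∈ I, HasDerivAt θ (K t) t) : StrictMonoOn θ I :=
  strictMonoOn_of_hasDerivWithinAt_pos hc.ordConnected.convex
    (fun t ht => (hθ t ht).continuousAt.continuousWithinAt)
    (fun t ht => (hθ t (interior_subset ht)).hasDerivWithinAt)
    fun t ht => hc.K_pos t (interior_subset ht)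

theorem one_sub_yCoord_sq (ht : t ∈ I) : 1 - yCoord ψ K t ^ 2 = 3 * V (φ t) / K t ^ 2 := by
  have hK := (hc.K_pos t ht).ne'
  rw [yCoord, div_pow, mul_pow, Real.sq_sqrt (by norm_num), eq_div_iff (by positivity), sub_mul,
    div_mul_cancel₀ _ (by positivity), hc.constraint t ht]
  ring

theorem exists_forall_le_lt (ho : OriginatesAtPN N I φ ψ K) (B : ℝ) :
    ∃ t₀ ∈ I, ∀ t ∈ I, t ≤ t₀ → B < φ t := by
  have := hc.nonempty.to_subtype
  obtain ⟨s, hs⟩ := eventually_atBot.1 (ho.1.eventually (eventually_gt_atTop B))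
  exact ⟨s, s.2, fun t ht hle => hs ⟨t, ht⟩ hle⟩

variable (hf : IsAdmissibleCoordinate k V N f φ₀)
include hf

theorem hasDerivAt_yCoord (ht : t ∈ I) (hφ : φ₀ ≤ φ t) :
    HasDerivAt (yCoord ψ K)
      (K t * (planarField (Wbar V N f φ₀) (fbar f φ₀) N (trace f φ ψ K t)).1) t := by
  have hK := (hc.K_pos t ht).ne'
  have hV := (hf.V_pos _ hφ).ne'
  refine (((hc.deriv_ψ t ht).const_mul (√(3 / 2))).div (hc.deriv_K t ht) hK).congr_deriv ?_
  simp only [planarField, trace]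
  rw [hc.one_sub_yCoord_sq ht, hf.Wbar_add hφ, yCoord, sqrt_three_halves]
  field_simp
  linear_combination (-2 * ψ t) * hc.constraint t ht

theorem hasDerivAt_apply (ht : t ∈ I) (hφ : φ₀ < φ t) :
    HasDerivAt (fun t => f (φ t))
      (K t * (planarField (Wbar V N f φ₀) (fbar f φ₀) N (trace f φ ψ K t)).2) t := by
  have hK := (hc.K_pos t ht).ne'
  have hsqrt : √(2 / 3 : ℝ) * √(3 / 2) = 1 := by
    rw [← Real.sqrt_mul (by norm_num)]; norm_num
  refine ((hf.hasDerivAt hφ).comp t (hc.deriv_φ t ht)).congr_deriv ?_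
  simp only [planarField, trace, yCoord]
  field_simp
  linear_combination -(fbar f φ₀ (f (φ t)) * ψ t) * hsqrt

theorem hasDerivAt_trace (ht : t ∈ I) (hφ : φ₀ < φ t) :
    HasDerivAt (trace f φ ψ K)
      (K t • planarField (Wbar V N f φ₀) (fbar f φ₀) N (trace f φ ψ K t)) t :=
  (hc.hasDerivAt_yCoord hf ht hφ.le).prodMk (hc.hasDerivAt_apply hf ht hφ)

theorem trace_mem_strip (ht : t ∈ I) (hφ : φ₀ < φ t) : trace f φ ψ K t ∈ strip (f φ₀) := by
  have hpos : 0 < 1 - yCoord ψ K t ^ 2 := by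
    rw [hc.one_sub_yCoord_sq ht]
    have hK := hc.K_pos t ht
    have hV := hf.V_pos _ hφ.le
    positivity
  exact ⟨abs_lt.1 ((sq_lt_one_iff_abs_lt_one _).1 (sub_pos.1 hpos)), (hf.apply_mem hφ.le).1,
    hf.strictAntiOn Set.self_mem_Ici hφ.le hφ⟩

variable (D : PlanarData (Wbar V N f φ₀) (fbar f φ₀) N (f φ₀))
include D

section Primitive

variable (hφ : ∀ t ∈ I, t ≤ t₀ → φ₀ < φ t) (hθ : ∀ t ∈ I, HasDerivAt θ (K t) t)
include hφ hθ

theorem exists_antitoneOn_log_sub :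
    ∃ C > 0, AntitoneOn (fun t => Real.log (f (φ t)) - C * θ t) (I ∩ Set.Iic t₀) := by
  obtain ⟨C, hC, hbound⟩ := D.exists_norm_snd_planarField_le
  have hderiv : ∀ t ∈ I ∩ Set.Iic t₀, HasDerivAt (fun t => Real.log (f (φ t)) - C * θ t)
      (K t * (planarField (Wbar V N f φ₀) (fbar f φ₀) N (trace f φ ψ K t)).2 / f (φ t) - C * K t)
      t := fun t ht => ((hc.hasDerivAt_apply hf ht.1 (hφ t ht.1 ht.2)).log
    (hf.apply_mem (hφ t ht.1 ht.2).le).1.ne').sub ((hθ t ht.1).const_mul C)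
  refine ⟨C, hC, antitoneOn_of_hasDerivWithinAt_nonpos
    (hc.ordConnected.convex.inter (convex_Iic t₀))
    (fun t ht => (hderiv t ht).continuousAt.continuousWithinAt)
    (fun t ht => (hderiv t (interior_subset ht)).hasDerivWithinAt) fun t ht => ?_⟩
  obtain ⟨htI, hle⟩ := interior_subset ht
  have hmem := hc.trace_mem_strip hf htI (hφ t htI hle)
  have hz : 0 < f (φ t) := hmem.2.1
  have hsnd : (planarField (Wbar V N f φ₀) (fbar f φ₀) N (trace f φ ψ K t)).2 ≤ C * f (φ t) :=
    ((le_abs_self _).trans (hbound _ (strip_subset_extStrip _ hmem))).trans_eq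
      (congrArg (C * ·) (Real.norm_of_nonneg hz.le))
  rw [sub_nonpos, div_le_iff₀ hz]
  calc K t * (planarField (Wbar V N f φ₀) (fbar f φ₀) N (trace f φ ψ K t)).2
      ≤ K t * (C * f (φ t)) := mul_le_mul_of_nonneg_left hsnd (hc.K_pos t htI).le
    _ = C * K t * f (φ t) := by ring

-- `z = f φ` reaches `0` at the left end of `I`, but decays at most exponentially in `θ`.
theorem tendsto_primitive_atBot (ht₀ : t₀ ∈ I) (ho : OriginatesAtPN N I φ ψ K) :
    Tendsto (fun t : I => θ t) atBot atBot := by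
  obtain ⟨C, hC, hanti⟩ := hc.exists_antitoneOn_log_sub hf D hφ hθ
  have := hc.nonempty.to_subtype
  have hlog : Tendsto (fun t : I => Real.log (f (φ t))) atBot atBot := by
    have hz : Tendsto (fun t : I => f (φ t)) atBot (𝓝[>] 0) := by
      rw [← hf.map_atTop]
      exact tendsto_map.comp ho.1
    exact Real.tendsto_log_nhdsGT_zero.comp hz
  refine tendsto_atBot_mono' atBot ?_
    ((tendsto_atBot_add_const_right atBot (C * θ t₀ - Real.log (f (φ t₀))) hlog).atBot_div_const hC)
  filter_upwards [eventually_le_atBot (⟨t₀, ht₀⟩ : I)] with t ht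
  have hle := hanti ⟨t.2, ht⟩ ⟨ht₀, Set.self_mem_Iic⟩ ht
  rw [le_div_iff₀ hC]
  linarith

theorem image_primitive_Iic (ht₀ : t₀ ∈ I) (ho : OriginatesAtPN N I φ ψ K) :
    θ '' (I ∩ Set.Iic t₀) = Set.Iic (θ t₀) := by
  have hmono := hc.strictMonoOn_primitive hθ
  refine Set.Subset.antisymm ?_ fun τ hτ => ?_
  · rintro _ ⟨t, ⟨ht, hle⟩, rfl⟩
    exact hmono.monotoneOn ht ht₀ hle
  · have := hc.nonempty.to_subtype
    obtain ⟨s, hs, hst₀⟩ := (((hc.tendsto_primitive_atBot hf D hφ hθ ht₀ ho).eventually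
      (eventually_le_atBot τ)).and (eventually_le_atBot (⟨t₀, ht₀⟩ : I))).exists
    have hsub : Set.Icc (s : ℝ) t₀ ⊆ I := hc.ordConnected.out s.2 ht₀
    obtain ⟨t, ht, rfl⟩ := intermediate_value_Icc (f := θ) hst₀
      (fun t ht => (hθ t (hsub ht)).continuousAt.continuousWithinAt) ⟨hs, hτ⟩
    exact ⟨t, ⟨hsub ht, ht.2⟩, rfl⟩

end Primitive

theorem exists_isSolutionOn_image_eq (ho : OriginatesAtPN N I φ ψ K) :
    ∃ γ : ℝ → ℝ × ℝ, ∃ T, ∃ t₀ ∈ I,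
      IsSolutionOn (planarField (Wbar V N f φ₀) (fbar f φ₀) N) (strip (f φ₀)) (Set.Iic T) γ ∧
      Tendsto γ atBot (𝓝 (pN N)) ∧ (∀ t ∈ I, t ≤ t₀ → φ₀ < φ t) ∧
      γ '' Set.Iic T = trace f φ ψ K '' (I ∩ Set.Iic t₀) := by
  obtain ⟨θ, hθ⟩ := hc.exists_primitive
  obtain ⟨t₀, ht₀, hφ⟩ := hc.exists_forall_le_lt ho φ₀
  have hmono := hc.strictMonoOn_primitive hθ
  have himage := hc.image_primitive_Iic hf D hφ hθ ht₀ ho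
  have hleft : Set.LeftInvOn (Function.invFunOn θ I) θ I := hmono.injOn.leftInvOn_invFunOn
  refine ⟨trace f φ ψ K ∘ Function.invFunOn θ I, θ t₀, t₀, ht₀, fun τ hτ => ?_, fun U hU => ?_,
    hφ, ?_⟩
  · rw [Set.mem_Iic, ← Set.mem_Iic, ← himage] at hτ
    obtain ⟨t, ⟨ht, hle⟩, rfl⟩ := hτ
    rw [Function.comp_apply, hleft ht]
    refine ⟨hc.trace_mem_strip hf ht (hφ t ht hle), HasDerivAt.hasDerivWithinAt ?_⟩
    have htrace := hc.hasDerivAt_trace hf ht (hφ t ht hle)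
    rw [← hleft ht] at htrace
    have hK := (hc.K_pos t ht).ne'
    simpa only [hleft ht, smul_smul, inv_mul_cancel₀ hK, one_smul] using
      htrace.scomp (θ t) (hasDerivAt_invFunOn hc.isOpen hθ hmono ht hK)
  · have := hc.nonempty.to_subtype
    obtain ⟨s, hs⟩ := eventually_atBot.1 (ho.tendsto_trace hf hU)
    change ∀ᶠ τ in atBot, trace f φ ψ K (Function.invFunOn θ I τ) ∈ U
    filter_upwards [eventually_le_atBot (θ t₀), eventually_le_atBot (θ s)] with τ hτ hτs
    rw [← Set.mem_Iic, ← himage] at hτ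
    obtain ⟨t, ⟨ht, -⟩, rfl⟩ := hτ
    rw [hleft ht]
    exact hs ⟨t, ht⟩ ((hmono.le_iff_le ht s.2).1 hτs)
  · rw [← himage, Set.image_comp, (hleft.mono Set.inter_subset_left).image_image]

end IsCosmology

/-! ### Uniqueness of cosmologies -/

theorem eqOn_of_locallyLipschitz {E : Type*} [NormedAddCommGroup E] [NormedSpace ℝ E]
    {F : E → E} (hF : LocallyLipschitz F) {s t : ℝ} {u v : ℝ → E}
    (hu : ∀ τ ∈ Set.uIcc s t, HasDerivWithinAt u (F (u τ)) (Set.uIcc s t) τ)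
    (hv : ∀ τ ∈ Set.uIcc s t, HasDerivWithinAt v (F (v τ)) (Set.uIcc s t) τ) (h : u s = v s) :
    Set.EqOn u v (Set.uIcc s t) := by
  have hcompact : IsCompact (u '' Set.uIcc s t ∪ v '' Set.uIcc s t) :=
    (isCompact_uIcc.image_of_continuousOn fun τ hτ => (hu τ hτ).continuousWithinAt).union
      (isCompact_uIcc.image_of_continuousOn fun τ hτ => (hv τ hτ).continuousWithinAt)
  obtain ⟨C, hC⟩ :=
    (hF.locallyLipschitzOn (s := _)).exists_lipschitzOnWith_of_compact hcompact
  exact eqOn_of_lipschitzOnWith hC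
    (fun τ hτ => ⟨.inl (Set.mem_image_of_mem u hτ), hu τ hτ⟩)
    (fun τ hτ => ⟨.inr (Set.mem_image_of_mem v hτ), hv τ hτ⟩) h

/-- The evolution equations of a cosmology, as a vector field in the variables `(φ, ψ, K)`. -/
noncomputable def cosmologyField (V : ℝ → ℝ) (p : ℝ × ℝ × ℝ) : ℝ × ℝ × ℝ :=
  (p.2.1, -p.2.2 * p.2.1 - deriv V p.1, -(3 / 2) * p.2.1 ^ 2)

theorem contDiff_cosmologyField {V : ℝ → ℝ} (hV : ContDiff ℝ 2 V) :
    ContDiff ℝ 1 (cosmologyField V) := by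
  have hderiv : ContDiff ℝ 1 fun p : ℝ × ℝ × ℝ => deriv V p.1 :=
    (contDiff_succ_iff_deriv (n := 1).1 (by rwa [one_add_one_eq_two])).2.2.comp contDiff_fst
  exact contDiff_snd.fst.prodMk
    ((ContDiff.sub (by fun_prop) hderiv).prodMk (contDiff_const.mul (contDiff_snd.fst.pow 2)))

namespace IsCosmology

variable {k : ℕ} {V f : ℝ → ℝ} {N φ₀ c s t : ℝ} {I I₁ I₂ : Set ℝ}
  {φ ψ K φ₁ ψ₁ K₁ φ₂ ψ₂ K₂ : ℝ → ℝ}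

theorem hasDerivAt_cosmologyField (hc : IsCosmology V I φ ψ K) (ht : t ∈ I) :
    HasDerivAt (fun t => (φ t, ψ t, K t)) (cosmologyField V (φ t, ψ t, K t)) t :=
  (hc.deriv_φ t ht).prodMk ((hc.deriv_ψ t ht).prodMk (hc.deriv_K t ht))

theorem eq_of_eq_at (hV : ContDiff ℝ 2 V) (h₁ : IsCosmology V I₁ φ₁ ψ₁ K₁)
    (h₂ : IsCosmology V I₂ φ₂ ψ₂ K₂) (hs₁ : s ∈ I₁) (hs₂ : s + c ∈ I₂)
    (heq : (φ₁ s, ψ₁ s, K₁ s) = (φ₂ (s + c), ψ₂ (s + c), K₂ (s + c)))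
    (ht₁ : t ∈ I₁) (ht₂ : t + c ∈ I₂) :
    (φ₁ t, ψ₁ t, K₁ t) = (φ₂ (t + c), ψ₂ (t + c), K₂ (t + c)) := by
  refine eqOn_of_locallyLipschitz (contDiff_cosmologyField hV).locallyLipschitz
    (u := fun τ => (φ₁ τ, ψ₁ τ, K₁ τ)) (v := fun τ => (φ₂ (τ + c), ψ₂ (τ + c), K₂ (τ + c)))
    (fun τ hτ => ?_) (fun τ hτ => ?_) heq Set.right_mem_uIcc
  · exact (h₁.hasDerivAt_cosmologyField
      (h₁.ordConnected.uIcc_subset hs₁ ht₁ hτ)).hasDerivWithinAt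
  · have hτ₂ : τ + c ∈ I₂ := by
      refine h₂.ordConnected.uIcc_subset hs₂ ht₂ ?_
      rw [← Set.image_add_const_uIcc]
      exact Set.mem_image_of_mem _ hτ
    exact ((h₂.hasDerivAt_cosmologyField hτ₂).comp_add_const τ c).hasDerivWithinAt

-- Otherwise `φ₁` would be unbounded on a compact interval, since `φ₂ → ∞` towards the past.
theorem add_mem_of_le (hV : ContDiff ℝ 2 V) (h₁ : IsCosmology V I₁ φ₁ ψ₁ K₁)
    (h₂ : IsCosmology V I₂ φ₂ ψ₂ K₂) (ho : OriginatesAtPN N I₂ φ₂ ψ₂ K₂) (hs₁ : s ∈ I₁)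
    (hs₂ : s + c ∈ I₂)
    (heq : (φ₁ s, ψ₁ s, K₁ s) = (φ₂ (s + c), ψ₂ (s + c), K₂ (s + c))) (hts : t ≤ s)
    (ht : t ∈ I₁) : t + c ∈ I₂ := by
  by_contra hno
  have hsub : Set.Icc t s ⊆ I₁ := h₁.ordConnected.out ht hs₁
  obtain ⟨B, hB⟩ := isCompact_Icc.bddAbove_image (f := φ₁) (K := Set.Icc t s)
    fun τ hτ => (h₁.deriv_φ τ (hsub hτ)).continuousAt.continuousWithinAt
  obtain ⟨r, hr, hrB⟩ := h₂.exists_forall_le_lt ho B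
  obtain ⟨u, hu⟩ : ∃ u, u + c = min r (s + c) := ⟨_, sub_add_cancel _ c⟩
  have hu₂ : u + c ∈ I₂ := by
    rw [hu]
    exact min_rec' (· ∈ I₂) hr hs₂
  have hus : u ≤ s := by linarith [min_le_right r (s + c)]
  have htu : t ≤ u := by
    by_contra! hlt
    exact hno (h₂.ordConnected.out hu₂ hs₂ ⟨by linarith, by linarith⟩)
  have hφ : φ₁ u = φ₂ (u + c) :=
    congrArg Prod.fst (h₁.eq_of_eq_at hV h₂ hs₁ hs₂ heq (hsub ⟨htu, hus⟩) hu₂)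
  have hlt : B < φ₂ (u + c) := hrB _ hu₂ (hu.trans_le (min_le_left _ _))
  exact hlt.not_ge (hφ ▸ hB (Set.mem_image_of_mem φ₁ ⟨htu, hus⟩))

theorem sameCosmology_of_eq_at (hV : ContDiff ℝ 2 V) (h₁ : IsCosmology V I₁ φ₁ ψ₁ K₁)
    (ho₁ : OriginatesAtPN N I₁ φ₁ ψ₁ K₁) (h₂ : IsCosmology V I₂ φ₂ ψ₂ K₂)
    (ho₂ : OriginatesAtPN N I₂ φ₂ ψ₂ K₂) (hs : s ∈ I₁) (ht : t ∈ I₂)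
    (heq : (φ₁ s, ψ₁ s, K₁ s) = (φ₂ t, ψ₂ t, K₂ t)) :
    SameCosmology I₁ φ₁ ψ₁ K₁ I₂ φ₂ ψ₂ K₂ := by
  obtain ⟨c, rfl⟩ : ∃ c, s + c = t := ⟨t - s, add_sub_cancel s t⟩
  have hs' : s + c + -c = s := add_neg_cancel_right s c
  refine ⟨c, ⟨s, hs, fun τ hτ => ⟨h₁.add_mem_of_le hV h₂ ho₂ hs ht heq hτ, fun hτ₂ => ?_⟩⟩,
    fun τ hτ₁ hτ₂ => ?_⟩
  · have hmem := h₂.add_mem_of_le hV h₁ ho₁ (c := -c) ht (by rwa [hs']) (by rw [hs', heq])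
      (by linarith : τ + c ≤ s + c) hτ₂
    rwa [add_neg_cancel_right] at hmem
  · simpa only [Prod.mk.injEq] using h₁.eq_of_eq_at hV h₂ hs ht heq hτ₁ hτ₂

theorem eq_of_trace_eq (h₁ : IsCosmology V I₁ φ₁ ψ₁ K₁) (h₂ : IsCosmology V I₂ φ₂ ψ₂ K₂)
    (hf : IsAdmissibleCoordinate k V N f φ₀) (hs : s ∈ I₁) (ht : t ∈ I₂) (hφs : φ₀ ≤ φ₁ s)
    (hφt : φ₀ ≤ φ₂ t) (heq : trace f φ₁ ψ₁ K₁ s = trace f φ₂ ψ₂ K₂ t) :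
    (φ₁ s, ψ₁ s, K₁ s) = (φ₂ t, ψ₂ t, K₂ t) := by
  have hy : yCoord ψ₁ K₁ s = yCoord ψ₂ K₂ t := congrArg Prod.fst heq
  have hφ : φ₁ s = φ₂ t := hf.strictAntiOn.injOn hφs hφt (congrArg Prod.snd heq)
  have hK₁ := h₁.K_pos s hs
  have hK₂ := h₂.K_pos t ht
  have hV := hf.V_pos _ hφt
  have hKsq : K₁ s ^ 2 = K₂ t ^ 2 := by
    have hquot := h₁.one_sub_yCoord_sq hs
    rw [hy, h₂.one_sub_yCoord_sq ht, hφ, div_eq_div_iff (by positivity) (by positivity)] at hquot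
    exact mul_left_cancel₀ (by positivity) hquot
  have hK : K₁ s = K₂ t := (pow_left_inj₀ hK₁.le hK₂.le two_ne_zero).1 hKsq
  rw [yCoord, yCoord, hK, div_left_inj' hK₂.ne'] at hy
  rw [hφ, hK, mul_left_cancel₀ (by positivity) hy]

theorem exists_trace_eq (h₁ : IsCosmology V I₁ φ₁ ψ₁ K₁) (ho₁ : OriginatesAtPN N I₁ φ₁ ψ₁ K₁)
    (h₂ : IsCosmology V I₂ φ₂ ψ₂ K₂) (ho₂ : OriginatesAtPN N I₂ φ₂ ψ₂ K₂)
    (hf : IsAdmissibleCoordinate k V N f φ₀)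
    (D : PlanarData (Wbar V N f φ₀) (fbar f φ₀) N (f φ₀)) :
    ∃ s ∈ I₁, ∃ t ∈ I₂, φ₀ < φ₁ s ∧ φ₀ < φ₂ t ∧
      trace f φ₁ ψ₁ K₁ s = trace f φ₂ ψ₂ K₂ t := by
  obtain ⟨δ, h, h', hδ, H⟩ := D.exists_invariantGraph
  obtain ⟨γ₁, T₁, s₀, -, hγ₁, hlim₁, hφ₁, himage₁⟩ := h₁.exists_isSolutionOn_image_eq hf D ho₁
  obtain ⟨γ₂, T₂, t₀, -, hγ₂, hlim₂, hφ₂, himage₂⟩ := h₂.exists_isSolutionOn_image_eq hf D ho₂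
  obtain ⟨z₁, hz₁, hcover₁⟩ := H.exists_eq_of_tendsto D hδ.le hγ₁ hlim₁
  obtain ⟨z₂, hz₂, hcover₂⟩ := H.exists_eq_of_tendsto D hδ.le hγ₂ hlim₂
  have hz : 0 < min z₁ z₂ := lt_min hz₁ hz₂
  obtain ⟨τ₁, hτ₁, heq₁⟩ := hcover₁ _ ⟨hz, min_le_left _ _⟩
  obtain ⟨τ₂, hτ₂, heq₂⟩ := hcover₂ _ ⟨hz, min_le_right _ _⟩
  obtain ⟨s, ⟨hs, hss₀⟩, htrace_s⟩ := himage₁.subset (Set.mem_image_of_mem γ₁ hτ₁)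
  obtain ⟨t, ⟨ht, htt₀⟩, htrace_t⟩ := himage₂.subset (Set.mem_image_of_mem γ₂ hτ₂)
  exact ⟨s, hs, t, ht, hφ₁ s hs hss₀, hφ₂ t ht htt₀,
    by rw [htrace_s, htrace_t, heq₁, heq₂]⟩

theorem sameCosmology (hV : ContDiff ℝ 2 V) (h₁ : IsCosmology V I₁ φ₁ ψ₁ K₁)
    (ho₁ : OriginatesAtPN N I₁ φ₁ ψ₁ K₁) (h₂ : IsCosmology V I₂ φ₂ ψ₂ K₂)
    (ho₂ : OriginatesAtPN N I₂ φ₂ ψ₂ K₂) (hf : IsAdmissibleCoordinate k V N f φ₀)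
    (D : PlanarData (Wbar V N f φ₀) (fbar f φ₀) N (f φ₀)) :
    SameCosmology I₁ φ₁ ψ₁ K₁ I₂ φ₂ ψ₂ K₂ := by
  obtain ⟨s, hs, t, ht, hφs, hφt, htrace⟩ := h₁.exists_trace_eq ho₁ h₂ ho₂ hf D
  exact h₁.sameCosmology_of_eq_at hV ho₁ h₂ ho₂ hs ht
    (h₁.eq_of_trace_eq h₂ hf hs ht hφs.le hφt.le htrace)

end IsCosmology

/-! ### The orbit `C_N` -/

section Orbit

variable {w g h h' : ℝ → ℝ} {N ε δ T : ℝ} {γ : ℝ → ℝ × ℝ}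

theorem InvariantGraph.mem_insert_orbit (H : InvariantGraph w g N δ h h')
    (D : PlanarData w g N ε) (hδ : δ ≤ ε) (hne : ∀ z ∈ Set.Ioo 0 δ, h z ≠ 0)
    (hγ : IsSolutionOn (planarField w g N) (extStrip ε) (Set.Iic T) γ)
    (hlim : Tendsto γ atBot (𝓝 (pN N))) {τ : ℝ} (hτ : τ ≤ T) :
    γ τ ∈ insert (pN N)
      {q | Joined (planarField w g N) (strip ε) (h (δ / 2), δ / 2) q} := by
  rcases D.isSolutionOn_strip_or_eq_pN hγ hlim with hstrip | hconst
  · obtain ⟨U, hU, horbit⟩ := H.exists_nhds_insert_orbit_inter_eq D hδ hne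
    obtain ⟨σ, ⟨⟨hσδ, hσh⟩, hσU⟩, hσ⟩ := (((H.eventually_fst_eq D hδ hγ hlim).and
      (hlim.eventually hU)).and (eventually_le_atBot T)).exists
    have hpos : 0 < (γ σ).2 := (hstrip σ hσ).1.2.1
    have hmem := (horbit.superset ⟨⟨⟨hpos.le, hσδ⟩, hσh⟩, hσU⟩).1
    refine .inr (D.joined_trans (hmem.resolve_left fun h0 => ?_)
      ⟨γ, σ, τ, hstrip.mono le_rfl fun ρ hρ => hρ.2.trans (max_le hσ hτ), rfl, rfl⟩)
    exact hpos.ne' (congrArg Prod.snd h0)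
  · exact .inl (hconst τ hτ)

theorem PlanarData.exists_orbit_of_eventually_ne (D : PlanarData w g N ε)
    (hne : ∀ᶠ z in 𝓝[>] 0, w z + N ≠ 0) :
    ∃ δ h h', ∃ C, δ ≤ ε ∧ InvariantGraph w g N δ h h' ∧ IsOrbit (planarField w g N) (strip ε) C ∧
      (∀ T γ, IsSolutionOn (planarField w g N) (extStrip ε) (Set.Iic T) γ →
        Tendsto γ atBot (𝓝 (pN N)) → ∀ τ ≤ T, γ τ ∈ insert (pN N) C) ∧
      ∃ U ∈ 𝓝 (pN N), insert (pN N) C ∩ U = {p | p.2 ∈ Set.Ico 0 δ ∧ p.1 = h p.2} ∩ U := by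
  obtain ⟨δ₀, h, h', hδ₀, H₀⟩ := D.exists_invariantGraph
  obtain ⟨δ₁, hδ₁, hne₁⟩ := mem_nhdsGT_iff_exists_Ioo_subset.1 hne
  have H := H₀.mono (lt_min H₀.pos hδ₁) (min_le_left δ₀ δ₁)
  have hδ : min δ₀ δ₁ ≤ ε := (min_le_left _ _).trans hδ₀.le
  have hmid : min δ₀ δ₁ / 2 ∈ Set.Ioo 0 (min δ₀ δ₁) := ⟨half_pos H.pos, half_lt_self H.pos⟩
  have hh : ∀ z ∈ Set.Ioo 0 (min δ₀ δ₁), h z ≠ 0 := fun z hz =>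
    H.ne_zero (fun z hz => hne₁ ⟨hz.1, hz.2.trans_le (min_le_right _ _)⟩) hz
  exact ⟨_, h, h', _, hδ, H,
    ⟨_, ⟨abs_lt.1 (H.abs_lt _ (Set.Ioo_subset_Ico_self hmid)), hmid.1, hmid.2.trans_le hδ⟩, rfl⟩,
    fun T γ hγ hlim τ hτ => H.mem_insert_orbit D hδ hh hγ hlim hτ,
    H.exists_nhds_insert_orbit_inter_eq D hδ hh⟩

theorem PlanarData.eq_pN_of_frequently (D : PlanarData w g N ε)
    (hfreq : ∃ᶠ z in 𝓝[>] 0, w z + N = 0)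
    (hγ : IsSolutionOn (planarField w g N) (extStrip ε) (Set.Iic T) γ)
    (hlim : Tendsto γ atBot (𝓝 (pN N))) : ∀ τ ≤ T, γ τ = pN N :=
  (D.isSolutionOn_strip_or_eq_pN hγ hlim).resolve_left fun hstrip =>
    D.not_tendsto_pN_of_frequently hfreq hstrip hlim

end Orbit

section Cosmology

variable {k : ℕ} {V f : ℝ → ℝ} {N φ₀ : ℝ}

theorem IsAdmissibleCoordinate.exists_isOrbit (hf : IsAdmissibleCoordinate k V N f φ₀)
    (D : PlanarData (Wbar V N f φ₀) (fbar f φ₀) N (f φ₀)) :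
    ∃ C, IsOrbit (field V N f φ₀) (phaseSpace f φ₀) C ∧
      (∀ (T : ℝ) (γ : ℝ → ℝ × ℝ), IsPastAsymptotic V N f φ₀ (extPhaseSpace f φ₀) T γ →
        ∀ τ ≤ T, γ τ ∈ insert (pN N) C) ∧
      ((∀ᶠ φ in atTop, deriv V φ ≠ 0) → IsLocallyCenterManifold V N f φ₀ C) := by
  by_cases hfreq : ∃ᶠ φ in atTop, deriv V φ = 0
  · have hmem : ((0 : ℝ), f φ₀ / 2) ∈ phaseSpace f φ₀ :=
      ⟨by norm_num, half_pos D.pos, half_lt_self D.pos⟩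
    exact ⟨_, ⟨_, hmem, rfl⟩, fun T γ hγ τ hτ => .inl (D.eq_pN_of_frequently
      (hf.frequently_Wbar_add_eq_zero_iff.2 hfreq) hγ.1 hγ.2 τ hτ), fun hne => (hfreq hne).elim⟩
  · obtain ⟨δ, h, h', C, hδ, H, hC, hpast, hlocal⟩ := D.exists_orbit_of_eventually_ne
      (not_frequently.1 (hf.frequently_Wbar_add_eq_zero_iff.not.2 hfreq))
    exact ⟨C, hC, fun T γ hγ => hpast T γ hγ.1 hγ.2, fun _ =>
      ⟨_, H.isLocalCenterManifold D hδ, hlocal⟩⟩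

theorem IsCosmology.eventually_trace_mem {I : Set ℝ} {φ ψ K : ℝ → ℝ}
    (hc : IsCosmology V I φ ψ K) (ho : OriginatesAtPN N I φ ψ K)
    (hf : IsAdmissibleCoordinate k V N f φ₀)
    (D : PlanarData (Wbar V N f φ₀) (fbar f φ₀) N (f φ₀)) {C : Set (ℝ × ℝ)}
    (hC : ∀ (T : ℝ) (γ : ℝ → ℝ × ℝ), IsPastAsymptotic V N f φ₀ (extPhaseSpace f φ₀) T γ →
      ∀ τ ≤ T, γ τ ∈ insert (pN N) C) :
    ∀ᶠ t : I in atBot, trace f φ ψ K t ∈ C := by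
  obtain ⟨γ, T, t₀, ht₀, hγ, hlim, -, himage⟩ := hc.exists_isSolutionOn_image_eq hf D ho
  filter_upwards [eventually_le_atBot (⟨t₀, ht₀⟩ : I)] with t ht
  obtain ⟨τ, hτ, hγτ⟩ := himage.superset (Set.mem_image_of_mem _ ⟨t.2, ht⟩)
  have hpos : 0 < (γ τ).2 := (hγ τ hτ).1.2.1
  rw [← hγτ]
  exact (hC T γ ⟨hγ.mono (strip_subset_extStrip _) le_rfl, hlim⟩ τ hτ).resolve_left fun h0 =>
    hpos.ne' (congrArg Prod.snd h0)

theorem IsLocalCenterManifold.eventually_mem {M : Set (ℝ × ℝ)}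
    (hM : IsLocalCenterManifold V N f φ₀ M)
    (D : PlanarData (Wbar V N f φ₀) (fbar f φ₀) N (f φ₀)) {T : ℝ} {γ : ℝ → ℝ × ℝ}
    (hγ : IsPastAsymptotic V N f φ₀ (extPhaseSpace f φ₀) T γ) : ∀ᶠ τ in atBot, γ τ ∈ M := by
  obtain ⟨δ, h, h', hδ, H, hsub⟩ := hM.exists_invariantGraph D
  filter_upwards [H.eventually_fst_eq D hδ hγ.1 hγ.2, eventually_le_atBot T] with τ hτ hτT
  exact hsub _ ⟨(hγ.1 τ hτT).1.2.1, hτ.1⟩ hτ.2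

theorem PlanarData.exists_isLocalCenterManifold
    (D : PlanarData (Wbar V N f φ₀) (fbar f φ₀) N (f φ₀)) :
    ∃ M, IsLocalCenterManifold V N f φ₀ M :=
  let ⟨_, _, _, hδ, H⟩ := D.exists_invariantGraph
  ⟨_, H.isLocalCenterManifold D hδ.le⟩

end Cosmology

end ScalarCosmology

theorem mainTheorem5 (V : ℝ → ℝ) (N : ℝ) (hV : IsClassWBI 2 V N) (hN : N ^ 2 < 6)
    (f : ℝ → ℝ) (φ₀ : ℝ) (hf : IsAdmissibleCoordinate 2 V N f φ₀) :
    -- there is a local center manifold, and each one contains every past-asymptotic solution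
    ((∃ M, IsLocalCenterManifold V N f φ₀ M) ∧
      ∀ M, IsLocalCenterManifold V N f φ₀ M → ∀ (T : ℝ) (γ : ℝ → ℝ × ℝ),
        IsPastAsymptotic V N f φ₀ (extPhaseSpace f φ₀) T γ → ∀ᶠ τ in atBot, γ τ ∈ M) ∧
    -- all past-asymptotic solutions lie on a single orbit `C`, locally a center manifold
    (∃ C, IsOrbit (field V N f φ₀) (phaseSpace f φ₀) C ∧
      (∀ (T : ℝ) (γ : ℝ → ℝ × ℝ), IsPastAsymptotic V N f φ₀ (extPhaseSpace f φ₀) T γ →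
        ∀ τ ≤ T, γ τ ∈ insert (pN N) C) ∧
      (∀ (I : Set ℝ) (φ ψ K : ℝ → ℝ), IsCosmology V I φ ψ K → OriginatesAtPN N I φ ψ K →
        ∀ᶠ t : I in atBot, (yCoord ψ K t, f (φ t)) ∈ C) ∧
      ((∀ᶠ φ in atTop, deriv V φ ≠ 0) → IsLocallyCenterManifold V N f φ₀ C)) ∧
    -- if `V'` has arbitrarily large zeros, no physical solution is past-asymptotic
    ((∃ᶠ φ in atTop, deriv V φ = 0) →
      ¬ ∃ (T : ℝ) (γ : ℝ → ℝ × ℝ), IsPastAsymptotic V N f φ₀ (phaseSpace f φ₀) T γ) ∧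
    -- at most one cosmology originates at the equilibrium
    (∀ (I₁ : Set ℝ) (φ₁ ψ₁ K₁ : ℝ → ℝ) (I₂ : Set ℝ) (φ₂ ψ₂ K₂ : ℝ → ℝ),
      IsCosmology V I₁ φ₁ ψ₁ K₁ → OriginatesAtPN N I₁ φ₁ ψ₁ K₁ →
      IsCosmology V I₂ φ₂ ψ₂ K₂ → OriginatesAtPN N I₂ φ₂ ψ₂ K₂ →
      SameCosmology I₁ φ₁ ψ₁ K₁ I₂ φ₂ ψ₂ K₂) := by
  have D := hf.planarData le_rfl hV.1 hN
  obtain ⟨C, hC, hpast, hlocal⟩ := hf.exists_isOrbit D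
  refine ⟨⟨D.exists_isLocalCenterManifold, fun M hM T γ hγ => hM.eventually_mem D hγ⟩,
    ⟨C, hC, hpast, fun I φ ψ K hc ho => hc.eventually_trace_mem ho hf D hpast, hlocal⟩, ?_, ?_⟩
  · rintro hfreq ⟨T, γ, hγ, hlim⟩
    exact D.not_tendsto_pN_of_frequently (hf.frequently_Wbar_add_eq_zero_iff.2 hfreq) hγ hlim
  · intro I₁ φ₁ ψ₁ K₁ I₂ φ₂ ψ₂ K₂ h₁ ho₁ h₂ ho₂
    exact h₁.sameCosmology hV.1.1 ho₁ h₂ ho₂ hf D
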